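/- For an integer $n\ge 0$ let $B_n$ be the Artin braid group on $n$ strings, with generators $\sigma_1,\dots,\sigma_{n-1}$ and relations $\sigma_i\sigma_j=\sigma_j\sigma_i$ for $|i-j|\ge 2$ and $\sigma_{i+1}\sigma_i\sigma_{i+1}=\sigma_i\sigma_{i+1}\sigma_i$. Let $P_n$ be the pure braid group, that is, the kernel of the homomorphism $B_n\to S_n$ with $\sigma_i\mapsto(i,\,i+1)$. A Bieberbach group of dimension $d$ is a torsion-free group isomorphic to a discrete and uniform (cocompact) subgroup of $\mathbb R^d\rtimes O(d,\mathbb R)$. It has holonomy group $\Phi$ if there is a short exact sequence $0\to\mathbb Z^d\to\Pi\to\Phi\to 1$ with $\Phi$ finite such that the action of $\Phi$ on $\mathbb Z^d$ induced by conjugation in $\Pi$ is faithful. **Proposition.** Let $H=\mathbb Z_{n_1}\times\cdots\times\mathbb Z_{n_t}$ $(t\ge 0)$, where each $n_i\geq 3$ is a power of a prime (the primes need not be distinct), and let $m$ be an integer with $\sum_{i=1}^t n_i\le m$. Then $\sum_{i=1}^t\binom{n_i}{2}\le\binom m2$, and the group $B_m/[P_m,P_m]$ has a Bieberbach subgroup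 $\Gamma$ of dimension $\sum_{i=1}^t\binom{n_i}{2}$ with holonomy group $H$. Moreover, $\Gamma$ can be taken of the form $\Gamma=\overline\iota(\Gamma_1\times\cdots\times\Gamma_t)$, where $\Gamma_i$ is a Bieberbach subgroup of $B_{n_i}/[P_{n_i},P_{n_i}]$ of dimension $\binom{n_i}{2}$ with holonomy group $\mathbb Z_{n_i}$, and $$\overline\iota\colon \frac{B_{n_1}}{[P_{n_1},P_{n_1}]}\times\cdots\times\frac{B_{n_t}}{[P_{n_t},P_{n_t}]}\to\frac{B_m}{[P_m,P_m]}$$ is an injective homomorphism sending the class of $\sigma_j$ in the $i$-th factor to the class of $\sigma_{n_1+\cdots+n_{i-1}+j}$, for $1\le i\le t$ and $1\le j\le n_i-1$. -/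

import Mathlib

/-! ### Artin braid groups -/

/-- The defining relators of the Artin braid group on `n` strings. The generator `σ_{i+1}` of the
usual presentation has the index `i : Fin (n - 1)`. -/
def braidRelators (n : ℕ) : Set (FreeGroup (Fin (n - 1))) :=
  {r | ∃ i j : Fin (n - 1), (i : ℕ) + 2 ≤ (j : ℕ) ∧
      r = (FreeGroup.of i * FreeGroup.of j) * (FreeGroup.of j * FreeGroup.of i)⁻¹} ∪
  {r | ∃ i j : Fin (n - 1), (j : ℕ) = (i : ℕ) + 1 ∧
      r = (FreeGroup.of j * FreeGroup.of i * FreeGroup.of j) *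
        (FreeGroup.of i * FreeGroup.of j * FreeGroup.of i)⁻¹}

/-- The Artin braid group `B_n` on `n` strings (trivial for `n = 0` and `n = 1`). -/
abbrev BraidGroup (n : ℕ) : Type := PresentedGroup (braidRelators n)

/-- The transposition `(i, i + 1)` of the `n` positions. -/
def adjTransposition (n : ℕ) (i : Fin (n - 1)) : Equiv.Perm (Fin n) :=
  Equiv.swap ⟨i, by omega⟩ ⟨(i : ℕ) + 1, by omega⟩

theorem adjTransposition_relators (n : ℕ) :
    ∀ r ∈ braidRelators n, FreeGroup.lift (adjTransposition n) r = 1 := by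
  rintro r (⟨i, j, hij, rfl⟩ | ⟨i, j, hij, rfl⟩)
  · rw [map_mul, map_inv, mul_inv_eq_one]
    simp only [map_mul, FreeGroup.lift_apply_of]
    refine (Equiv.Perm.disjoint_swap_swap ?_).commute.eq
    simp [Fin.ext_iff]
    omega
  · rw [map_mul, map_inv, mul_inv_eq_one]
    simp only [map_mul, FreeGroup.lift_apply_of, adjTransposition, hij]
    have key : ∀ a b c : Fin n, a ≠ b → a ≠ c → b ≠ c →
        Equiv.swap b c * Equiv.swap a b * Equiv.swap b c =
          Equiv.swap a b * Equiv.swap b c * Equiv.swap a b := by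
      intro a b c hab hac hbc
      rw [Equiv.swap_mul_swap_mul_swap hab hac, Equiv.swap_comm a b, Equiv.swap_comm b c,
        Equiv.swap_mul_swap_mul_swap hbc.symm hac.symm, Equiv.swap_comm]
    apply key <;> simp only [ne_eq, Fin.mk.injEq] <;> omega

/-- The homomorphism `σ : B_n → S_n` that sends each generator to the corresponding adjacent
transposition. (Reading products of permutations in the other order replaces the value of `σ` by
its inverse and leaves the kernel the same.) -/
def braidPerm (n : ℕ) : BraidGroup n →* Equiv.Perm (Fin n) :=
  PresentedGroup.toGroup (adjTransposition_relators n)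

/-- The pure braid group `P_n`, the kernel of `σ : B_n → S_n`. -/
def pureBraidGroup (n : ℕ) : Subgroup (BraidGroup n) := (braidPerm n).ker

instance pureBraidGroup_normal (n : ℕ) : (pureBraidGroup n).Normal :=
  (braidPerm n).normal_ker

/-- The quotient group `B_n / [P_n, P_n]`. -/
abbrev BraidQuotient (n : ℕ) : Type :=
  BraidGroup n ⧸ ⁅pureBraidGroup n, pureBraidGroup n⁆

/-- The image in `B_n / [P_n, P_n]` of the Artin generator with index `i`. -/
def braidQuotientGen (n : ℕ) (i : Fin (n - 1)) : BraidQuotient n :=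
  QuotientGroup.mk (PresentedGroup.of i : BraidGroup n)

/-! ### Crystallographic and Bieberbach groups -/

/-- The action of `O(n, ℝ)` on the additive group `ℝⁿ` by matrix multiplication. -/
def orthogonalAction (n : ℕ) :
    Matrix.orthogonalGroup (Fin n) ℝ →* MulAut (Multiplicative (Fin n → ℝ)) where
  toFun A := AddEquiv.toMultiplicative
    (Matrix.UnitaryGroup.toLinearEquiv A).toAddEquiv
  map_one' := by
    ext v
    simp [Matrix.UnitaryGroup.toLinearEquiv, Matrix.UnitaryGroup.toLin']
  map_mul' A B := by
    ext v
    simp [Matrix.UnitaryGroup.toLinearEquiv, Matrix.UnitaryGroup.toLin']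

/-- The group `ℝⁿ ⋊ O(n, ℝ)` of rigid motions of Euclidean `n`-space. The pair `(v, A)` is the
motion `x ↦ v + A x`. -/
abbrev EuclideanMotion (n : ℕ) : Type :=
  Multiplicative (Fin n → ℝ) ⋊[orthogonalAction n] Matrix.orthogonalGroup (Fin n) ℝ

/-- The standard topology of `ℝⁿ ⋊ O(n, ℝ)`: that of the product `ℝⁿ × O(n, ℝ)`. -/
instance EuclideanMotion.topologicalSpace (n : ℕ) : TopologicalSpace (EuclideanMotion n) :=
  TopologicalSpace.induced
    (fun g => (Multiplicative.toAdd g.left, g.right) :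
      EuclideanMotion n → (Fin n → ℝ) × Matrix.orthogonalGroup (Fin n) ℝ) inferInstance

/-- The group `Γ` is (isomorphic to) a crystallographic group of dimension `n`, that is, to a
discrete and uniform (i.e. cocompact) subgroup of `ℝⁿ ⋊ O(n, ℝ)`. -/
def IsCrystallographic (n : ℕ) (Γ : Type*) [Group Γ] : Prop :=
  ∃ C : Subgroup (EuclideanMotion n),
    DiscreteTopology C ∧ CompactSpace (EuclideanMotion n ⧸ C) ∧ Nonempty (Γ ≃* C)

/-- There is a short exact sequence `0 → ℤⁿ → Γ → Φ → 1` with `Φ` finite, for which the integral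
representation `Θ : Φ → Aut(ℤⁿ)` induced by conjugation in `Γ` is faithful. For a
crystallographic group `Γ` this says that `Γ` has dimension `n` and holonomy group `Φ`. -/
def HasHolonomyGroup (n : ℕ) (Φ Γ : Type*) [Group Φ] [Group Γ] : Prop :=
  Finite Φ ∧
  ∃ (S : GroupExtension (Multiplicative (Fin n → ℤ)) Γ Φ)
    (Θ : Φ →* MulAut (Multiplicative (Fin n → ℤ))),
    (∀ (γ : Γ) (x : Multiplicative (Fin n → ℤ)),
      S.inl (Θ (S.rightHom γ) x) = γ * S.inl x * γ⁻¹) ∧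
    Function.Injective Θ

/-- `Γ` is a Bieberbach group (a torsion-free crystallographic group) of dimension `n` with
holonomy group (isomorphic to) `Φ`. -/
structure IsBieberbach (n : ℕ) (Φ Γ : Type*) [Group Φ] [Group Γ] : Prop where
  crystallographic : IsCrystallographic n Γ
  torsionFree : ∀ γ : Γ, IsOfFinOrder γ → γ = 1
  holonomy : HasHolonomyGroup n Φ Γ

/-! The permutation of a braid together with the signed numbers of crossings of each pair of strands
defines a homomorphism from `B_n / [P_n, P_n]` to a semidirect product of the lattice of integer
functions on pairs of strands with `S_n`. It is injective: killing the squares of the Artin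
generators leaves the Coxeter presentation of `S_n`, so `P_n / [P_n, P_n]` is generated by one full
twist for each pair, and their crossing numbers are independent.

The product of all the generators is an `n`-cycle whose exponent sum is `-1` mod `n`, so the braids
whose permutation is a power of the cycle matching their exponent sum mod `n` form a subgroup. One
of its elements of finite order has exponent sum `0`, hence is pure, and the pure part is a free
abelian group; so the subgroup is torsion-free. For `n ≥ 3` the symmetric group acts faithfully on
pairs of strands, which makes the subgroup Bieberbach with holonomy `ℤ/n`.

Braids placed side by side can be recovered from the permutation and the crossing numbers inside
each block, so these subgroups multiply. -/

/-! ### The Coxeter presentation of the symmetric group -/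

section Coxeter

variable {K K' : Type*} [Group K] [Group K']

/-- The descending product `t (l + d - 1) * ⋯ * t (l + 1) * t l`. In the symmetric group these are
the representatives of minimal length of the cosets of a smaller symmetric group. -/
def descProd (t : ℕ → K) (l : ℕ) : ℕ → K
  | 0 => 1
  | d + 1 => t (l + d) * descProd t l d

/-- The subgroup generated by the first `j` members of a sequence, the analogue of a standard
parabolic subgroup. -/
def initialClosure (t : ℕ → K) (j : ℕ) : Subgroup K :=
  Subgroup.closure (t '' Set.Iio j)

/-- The braid relations for the first `k` members of a sequence. Sequences indexed by `ℕ` rather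
than families indexed by `Fin k` spare coercions between the index sets of subgroups. -/
structure BraidRelations (t : ℕ → K) (k : ℕ) : Prop where
  comm : ∀ i j, i + 2 ≤ j → j < k → t i * t j = t j * t i
  braid : ∀ i, i + 1 < k → t (i + 1) * t i * t (i + 1) = t i * t (i + 1) * t i

theorem initialClosure_zero (t : ℕ → K) : initialClosure t 0 = ⊥ := by
  simp [initialClosure]

theorem mem_initialClosure (t : ℕ → K) {i j : ℕ} (h : i < j) : t i ∈ initialClosure t j :=
  Subgroup.subset_closure ⟨i, h, rfl⟩

theorem map_initialClosure (f : K →* K') (t : ℕ → K) (j : ℕ) :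
    (initialClosure t j).map f = initialClosure (fun i => f (t i)) j := by
  rw [initialClosure, initialClosure, MonoidHom.map_closure, Set.image_image]

theorem map_descProd (f : K →* K') (t : ℕ → K) (l d : ℕ) :
    f (descProd t l d) = descProd (fun i => f (t i)) l d := by
  induction d with
  | zero => exact map_one f
  | succ d ih => rw [descProd, map_mul, ih, descProd]

theorem descProd_congr {t t' : ℕ → K} {l d : ℕ} (h : ∀ i < l + d, t i = t' i) :
    descProd t l d = descProd t' l d := by
  induction d with
  | zero => rfl
  | succ d ih => rw [descProd, descProd, h _ (by omega), ih fun i hi => h i (by omega)]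

theorem descProd_succ_mul (t : ℕ → K) (l d : ℕ) :
    descProd t (l + 1) d * t l = descProd t l (d + 1) := by
  induction d with
  | zero => simp [descProd]
  | succ d ih =>
    rw [descProd, mul_assoc, ih, show l + 1 + d = l + (d + 1) by ring]
    rfl

namespace BraidRelations

variable {t : ℕ → K} {k : ℕ}

theorem map (h : BraidRelations t k) (f : K →* K') : BraidRelations (fun i => f (t i)) k where
  comm i j hij hj := by rw [← map_mul, h.comm i j hij hj, map_mul]
  braid i hi := by simp only [← map_mul, h.braid i hi]

theorem descProd_mul_of_add_two_le (h : BraidRelations t k) {l d i : ℕ} (hd : l + d ≤ k)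
    (hi : i + 2 ≤ l) : descProd t l d * t i = t i * descProd t l d := by
  induction d with
  | zero => simp [descProd]
  | succ d ih =>
    rw [descProd, mul_assoc, ih (by omega), ← mul_assoc, ← h.comm i (l + d) (by omega) (by omega),
      mul_assoc]

theorem descProd_mul_of_add_lt (h : BraidRelations t k) {l d i : ℕ} (hd : l + d < i)
    (hi : i < k) : descProd t l d * t i = t i * descProd t l d := by
  induction d with
  | zero => simp [descProd]
  | succ d ih =>
    rw [descProd, mul_assoc, ih (by omega), ← mul_assoc, h.comm (l + d) i (by omega) (by omega),
      mul_assoc]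

theorem descProd_mul_succ (h : BraidRelations t k) {l d i : ℕ} (hd : l + d ≤ k)
    (hl : l ≤ i) (hi : i + 1 < l + d) :
    descProd t l d * t (i + 1) = t i * descProd t l d := by
  induction d with
  | zero => omega
  | succ d ih =>
    rcases lt_or_eq_of_le (show i + 1 ≤ l + d by omega) with hlt | heq
    · rw [descProd, mul_assoc, ih (by omega) hlt, ← mul_assoc,
        ← h.comm i (l + d) (by omega) (by omega), mul_assoc]
    · obtain ⟨e, rfl⟩ : ∃ e, d = e + 1 := ⟨d - 1, by omega⟩
      obtain rfl : i = l + e := by omega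
      rw [descProd, descProd, ← add_assoc, mul_assoc, mul_assoc,
        h.descProd_mul_of_add_lt (by omega) (by omega), ← mul_assoc, ← mul_assoc,
        h.braid _ (by omega)]
      simp only [mul_assoc]

theorem exists_mul_descProd_mul (h : BraidRelations t k) (hsq : ∀ i < k, t i * t i = 1) {j : ℕ}
    (hj : j < k) {y : K} (hy : y ∈ initialClosure t j) {l d : ℕ} (hld : l + d = j + 1) {i : ℕ}
    (hi : i ≤ j) : ∃ y' ∈ initialClosure t j, ∃ l' d', l' + d' = j + 1 ∧
      y * descProd t l d * t i = y' * descProd t l' d' := by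
  rcases lt_or_ge (i + 1) l with hil | hli
  · exact ⟨y * t i, mul_mem hy (mem_initialClosure t (by omega)), l, d, hld, by
      rw [mul_assoc, h.descProd_mul_of_add_two_le (by omega) (by omega), mul_assoc]⟩
  rcases hli.eq_or_lt with rfl | hli
  · exact ⟨y, hy, i, d + 1, by omega, by rw [mul_assoc, descProd_succ_mul]⟩
  rcases (Nat.lt_succ_iff.mp hli).eq_or_lt with rfl | hli
  · obtain ⟨e, rfl⟩ : ∃ e, d = e + 1 := ⟨d - 1, by omega⟩
    exact ⟨y, hy, l + 1, e, by omega, by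
      rw [← descProd_succ_mul, mul_assoc, mul_assoc, hsq l (by omega), mul_one]⟩
  · obtain ⟨i, rfl⟩ : ∃ e, i = e + 1 := ⟨i - 1, by omega⟩
    exact ⟨y * t i, mul_mem hy (mem_initialClosure t (by omega)), l, d, hld, by
      rw [mul_assoc, h.descProd_mul_succ (by omega) (by omega) (by omega), mul_assoc]⟩

theorem exists_eq_mul_descProd (h : BraidRelations t k) (hsq : ∀ i < k, t i * t i = 1) {j : ℕ}
    (hj : j < k) {x : K} (hx : x ∈ initialClosure t (j + 1)) :
    ∃ y ∈ initialClosure t j, ∃ l d, l + d = j + 1 ∧ x = y * descProd t l d := by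
  induction hx using Subgroup.closure_induction_right with
  | one => exact ⟨1, one_mem _, j + 1, 0, rfl, (mul_one 1).symm⟩
  | mul_right x _ _ hi ih =>
    obtain ⟨i, hi, rfl⟩ := hi
    obtain ⟨y, hy, l, d, hld, rfl⟩ := ih
    exact h.exists_mul_descProd_mul hsq hj hy hld (Nat.lt_succ_iff.mp hi)
  | mul_inv_cancel x _ _ hi ih =>
    obtain ⟨i, hi, rfl⟩ := hi
    obtain ⟨y, hy, l, d, hld, rfl⟩ := ih
    have hij : i ≤ j := Nat.lt_succ_iff.mp hi
    rw [inv_eq_of_mul_eq_one_left (hsq i (by omega))]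
    exact h.exists_mul_descProd_mul hsq hj hy hld hij

end BraidRelations

/-- The adjacent transpositions of `Fin n` as a sequence, with the junk value `1` from the index
`n - 1` on. -/
def adjSwap (n i : ℕ) : Equiv.Perm (Fin n) :=
  if h : i < n - 1 then adjTransposition n ⟨i, h⟩ else 1

theorem adjSwap_of_lt {n i : ℕ} (h : i + 1 < n) :
    adjSwap n i = Equiv.swap ⟨i, by omega⟩ ⟨i + 1, h⟩ := by
  rw [adjSwap, dif_pos (by omega)]
  rfl

theorem adjSwap_mul_self (n i : ℕ) : adjSwap n i * adjSwap n i = 1 := by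
  rw [adjSwap]
  split_ifs
  · exact Equiv.swap_mul_self _ _
  · exact mul_one 1

theorem coe_adjSwap_apply {n i : ℕ} (h : i + 1 < n) (a : Fin n) :
    (adjSwap n i a : ℕ) = if (a : ℕ) = i then i + 1 else if (a : ℕ) = i + 1 then i else a := by
  rw [adjSwap_of_lt h, Equiv.swap_apply_def]
  simp only [Fin.ext_iff]
  split_ifs <;> rfl

theorem coe_descProd_adjSwap_apply {n l d : ℕ} (h : l + d < n) (a : Fin n) :
    (descProd (adjSwap n) l d a : ℕ) =
      if (a : ℕ) = l then l + d else if l < a ∧ (a : ℕ) ≤ l + d then a - 1 else a := by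
  induction d with
  | zero =>
    simp only [descProd, Equiv.Perm.coe_one, id_eq, add_zero]
    grind
  | succ d ih =>
    rw [descProd, Equiv.Perm.mul_apply, coe_adjSwap_apply (by omega), ih (by omega)]
    split_ifs <;> omega

theorem initialClosure_adjSwap (n : ℕ) : initialClosure (adjSwap n) (n - 1) = ⊤ := by
  obtain _ | n := n
  · exact Subsingleton.elim _ _
  rw [eq_top_iff, ← Subgroup.toSubmonoid_le, Subgroup.top_toSubmonoid,
    ← Equiv.Perm.mclosure_swap_castSucc_succ n, Submonoid.closure_le]
  rintro _ ⟨i, rfl⟩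
  exact Subgroup.subset_closure ⟨i, i.2, by rw [adjSwap_of_lt (by omega)]; rfl⟩

section

variable {t : ℕ → K} {n : ℕ} {f : K →* Equiv.Perm (Fin n)}

theorem apply_eq_of_mem_initialClosure (hf : ∀ i < n - 1, f (t i) = adjSwap n i) {j : ℕ}
    (hj : j ≤ n - 1) {x : K} (hx : x ∈ initialClosure t j) {a : Fin n} (ha : j < a) :
    f x a = a := by
  induction hx using Subgroup.closure_induction with
  | mem x hx =>
    obtain ⟨i, hi, rfl⟩ := hx
    rw [Set.mem_Iio] at hi
    rw [hf i (by omega), Fin.ext_iff, coe_adjSwap_apply (by omega), if_neg (by omega),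
      if_neg (by omega)]
  | one => rw [map_one, Equiv.Perm.one_apply]
  | mul x y _ _ hx hy => rw [map_mul, Equiv.Perm.mul_apply, hy, hx]
  | inv x _ hx => rw [map_inv, Equiv.Perm.inv_eq_iff_eq, hx]

theorem mem_initialClosure_of_apply_eq (h : BraidRelations t (n - 1))
    (hsq : ∀ i < n - 1, t i * t i = 1) (hf : ∀ i < n - 1, f (t i) = adjSwap n i) {j : ℕ}
    (hj : j + 1 < n) {x : K} (hx : x ∈ initialClosure t (j + 1))
    (hfix : f x ⟨j + 1, hj⟩ = ⟨j + 1, hj⟩) : x ∈ initialClosure t j := by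
  obtain ⟨y, hy, l, d, hld, rfl⟩ := h.exists_eq_mul_descProd hsq (by omega) hx
  have hdesc : f (descProd t l d) ⟨l, by omega⟩ = ⟨j + 1, hj⟩ := by
    rw [map_descProd, descProd_congr (t' := adjSwap n) fun i hi => hf i (by omega), Fin.ext_iff,
      coe_descProd_adjSwap_apply (by omega), if_pos rfl, hld]
  have hl : f (y * descProd t l d) ⟨l, by omega⟩ = ⟨j + 1, hj⟩ := by
    rw [map_mul, Equiv.Perm.mul_apply, hdesc,
      apply_eq_of_mem_initialClosure hf (by omega) hy (Nat.lt_succ_self j)]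
  have hlj : l = j + 1 := congrArg Fin.val ((f _).injective (hl.trans hfix.symm))
  obtain rfl : d = 0 := by omega
  rwa [descProd, mul_one]

theorem eq_one_of_mem_initialClosure (h : BraidRelations t (n - 1))
    (hsq : ∀ i < n - 1, t i * t i = 1) (hf : ∀ i < n - 1, f (t i) = adjSwap n i) {j : ℕ}
    (hj : j ≤ n - 1) {x : K} (hx : x ∈ initialClosure t j) (hfx : f x = 1) : x = 1 := by
  induction j with
  | zero => exact (initialClosure_zero t).le hx
  | succ j ih =>
    exact ih (by omega) (mem_initialClosure_of_apply_eq h hsq hf (by omega) hx (by simp [hfx]))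

end

end Coxeter

/-! ### Generators of the braid group -/

section BraidGroup

variable {n : ℕ}

/-- The Artin generators as a sequence, with the junk value `1` from the index `n - 1` on. -/
def artinGen (n i : ℕ) : BraidGroup n :=
  if h : i < n - 1 then PresentedGroup.of ⟨i, h⟩ else 1

theorem artinGen_coe (i : Fin (n - 1)) : artinGen n i = PresentedGroup.of i :=
  dif_pos i.2

theorem braidPerm_artinGen (n i : ℕ) : braidPerm n (artinGen n i) = adjSwap n i := by
  rw [artinGen, adjSwap]
  split_ifs
  · exact PresentedGroup.toGroup.of _
  · exact map_one _

theorem braidRelations_artinGen (n : ℕ) : BraidRelations (artinGen n) (n - 1) where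
  comm i j hij hj := by
    rw [artinGen, artinGen, dif_pos hj, dif_pos (by omega)]
    exact PresentedGroup.mk_eq_mk_of_mul_inv_mem (.inl ⟨⟨i, by omega⟩, ⟨j, hj⟩, hij, rfl⟩)
  braid i hi := by
    rw [artinGen, artinGen, dif_pos hi, dif_pos (by omega)]
    exact PresentedGroup.mk_eq_mk_of_mul_inv_mem (.inr ⟨⟨i, by omega⟩, ⟨i + 1, hi⟩, rfl, rfl⟩)

theorem braidRelations_adjSwap (n : ℕ) : BraidRelations (adjSwap n) (n - 1) := by
  simpa only [braidPerm_artinGen] using (braidRelations_artinGen n).map (braidPerm n)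

theorem initialClosure_artinGen (n : ℕ) : initialClosure (artinGen n) (n - 1) = ⊤ := by
  rw [eq_top_iff, ← PresentedGroup.closure_range_of, initialClosure]
  apply Subgroup.closure_mono
  rintro _ ⟨i, rfl⟩
  exact ⟨i, i.2, artinGen_coe i⟩

theorem braidPerm_surjective (n : ℕ) : Function.Surjective (braidPerm n) := by
  rw [← MonoidHom.range_eq_top, MonoidHom.range_eq_map, ← initialClosure_artinGen,
    map_initialClosure, ← initialClosure_adjSwap]
  simp only [braidPerm_artinGen]

variable {K : Type*} [Group K]

/-- The homomorphism from the braid group given by a sequence that satisfies the braid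
relations. -/
def braidLift {t : ℕ → K} (h : BraidRelations t (n - 1)) : BraidGroup n →* K :=
  PresentedGroup.toGroup (f := fun i : Fin (n - 1) => t i) <| by
    rintro r (⟨i, j, hij, rfl⟩ | ⟨i, j, hij, rfl⟩)
    · rw [map_mul, map_inv, mul_inv_eq_one]
      simp only [map_mul, FreeGroup.lift_apply_of]
      exact h.comm i j hij j.2
    · rw [map_mul, map_inv, mul_inv_eq_one]
      simp only [map_mul, FreeGroup.lift_apply_of, hij]
      exact h.braid i (by omega)

theorem braidLift_artinGen {t : ℕ → K} (h : BraidRelations t (n - 1)) {i : ℕ}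
    (hi : i + 1 < n) : braidLift h (artinGen n i) = t i := by
  rw [artinGen, dif_pos (by omega)]
  exact PresentedGroup.toGroup.of _

theorem monoidHom_ext_artinGen {f g : BraidGroup n →* K}
    (h : ∀ i, i + 1 < n → f (artinGen n i) = g (artinGen n i)) : f = g :=
  PresentedGroup.ext fun i => by simpa only [artinGen_coe] using h i (by omega)

end BraidGroup

/-! ### Integral functions extended by a permutation group -/

/-- The semidirect product `ℤ^I ⋊ G` for an action of `G` on the set `I`. -/
abbrev IntWreath (I G : Type*) [Group G] [MulAction G I] : Type _ :=
  (I → Multiplicative ℤ) ⋊[mulAutArrow] G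

namespace IntWreath

variable {I G : Type*} [Group G] [MulAction G I]

theorem mulAutArrow_apply (g : G) (w : I → Multiplicative ℤ) (s : I) :
    mulAutArrow g w s = w (g⁻¹ • s) := rfl

theorem mul_left_apply (x y : IntWreath I G) (s : I) :
    (x * y).left s = x.left s * y.left (x.right⁻¹ • s) := rfl

theorem pow_left_of_right_eq_one {x : IntWreath I G} (hx : x.right = 1) (k : ℕ) :
    (x ^ k).left = x.left ^ k := by
  have hinl : SemidirectProduct.inl x.left = x := SemidirectProduct.ext rfl hx.symm
  rw [← congrArg (· ^ k) hinl, ← map_pow, SemidirectProduct.left_inl]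

theorem eq_one_of_isOfFinOrder {x : IntWreath I G} (hx : IsOfFinOrder x) (hr : x.right = 1) :
    x = 1 := by
  obtain ⟨k, hk, hxk⟩ := isOfFinOrder_iff_pow_eq_one.mp hx
  have hpow : x.left ^ k = 1 := by
    rw [← pow_left_of_right_eq_one hr, hxk, SemidirectProduct.one_left]
  exact SemidirectProduct.ext ((pow_eq_one_iff_left hk.ne').mp hpow) hr

theorem commute_of_right_eq_one {x y : IntWreath I G} (hx : x.right = 1) (hy : y.right = 1) :
    Commute x y :=
  SemidirectProduct.ext (by simp [hx, hy, mul_comm]) (by simp [hx, hy])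

/-- The sum of the values of the integral function. -/
def exponentSum [Fintype I] : IntWreath I G →* Multiplicative ℤ where
  toFun x := ∏ s, x.left s
  map_one' := Finset.prod_eq_one fun _ _ => rfl
  map_mul' x y := by
    simp only [mul_left_apply, Finset.prod_mul_distrib]
    exact congrArg _ (Equiv.prod_comp (MulAction.toPerm x.right⁻¹) y.left)

variable [DecidableEq I]

/-- The element of `ℤ^I ⋊ G` formed by the indicator function of `s` and the element `g`. -/
def single (s : I) (g : G) : IntWreath I G := ⟨Pi.mulSingle s (Multiplicative.ofAdd 1), g⟩

theorem mulAutArrow_mulSingle (g : G) (s : I) (z : Multiplicative ℤ) :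
    mulAutArrow g (Pi.mulSingle s z : I → Multiplicative ℤ) = Pi.mulSingle (g • s) z := by
  ext1 r
  simp only [mulAutArrow_apply, Pi.mulSingle_apply, inv_smul_eq_iff]

theorem single_mul_single (s r : I) (g h : G) : single s g * single r h =
    ⟨Pi.mulSingle s (Multiplicative.ofAdd 1) * Pi.mulSingle (g • r) (Multiplicative.ofAdd 1),
      g * h⟩ :=
  SemidirectProduct.ext (congrArg (_ * ·) (mulAutArrow_mulSingle g r _)) rfl

theorem exponentSum_single [Fintype I] (s : I) (g : G) :
    exponentSum (single s g) = Multiplicative.ofAdd 1 :=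
  Finset.univ.prod_pi_mulSingle' s _ |>.trans (if_pos (Finset.mem_univ s))

theorem single_mul_self {s : I} {g : G} (hg : g * g = 1) (hs : g • s = s) :
    single s g * single s g = SemidirectProduct.inl (Pi.mulSingle s (Multiplicative.ofAdd 2)) := by
  rw [single_mul_single, hs, hg, ← Pi.mulSingle_mul]
  rfl

theorem single_comm {s r : I} {g h : G} (hgh : g * h = h * g) (hr : g • r = r) (hs : h • s = s) :
    single s g * single r h = single r h * single s g := by
  rw [single_mul_single, single_mul_single, hr, hs, hgh, mul_comm (Pi.mulSingle s _)]

theorem single_braid {s r : I} {g h : G} (hgh : h * g * h = g * h * g) (hg : g * g = 1)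
    (hh : h * h = 1) (hsr : g • r = h • s) :
    single r h * single s g * single r h = single s g * single r h * single s g := by
  have hs : (h * g) • r = s := by rw [mul_smul, hsr, ← mul_smul, hh, one_smul]
  have hr : (g * h) • s = r := by rw [mul_smul, ← hsr, ← mul_smul, hg, one_smul]
  refine SemidirectProduct.ext ?_ hgh
  simp only [single_mul_single, SemidirectProduct.mul_left]
  rw [single, single, mulAutArrow_mulSingle, mulAutArrow_mulSingle, hs, hr, hsr]
  exact mul_right_comm _ _ _ |>.trans (by rw [mul_assoc, mul_comm])

theorem conj_inl_mulSingle (x : IntWreath I G) (s : I) (z : Multiplicative ℤ) :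
    x * SemidirectProduct.inl (Pi.mulSingle s z) * x⁻¹ =
      SemidirectProduct.inl (Pi.mulSingle (x.right • s) z) := by
  rw [mul_inv_eq_iff_eq_mul, ← mulAutArrow_mulSingle]
  exact SemidirectProduct.ext (by simp [mul_comm]) (by simp)

end IntWreath

/-! ### The linking homomorphism -/

section Linking

/-- The unordered pairs of strands. -/
abbrev StrandPair (n : ℕ) : Type := Set.powersetCard (Fin n) 2

/-- The pair of the strands `i` and `i + 1`. -/
def adjPair {n : ℕ} (i : ℕ) (h : i + 1 < n) : StrandPair n :=
  Set.powersetCard.ofCard (s := {⟨i, by omega⟩, ⟨i + 1, h⟩})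
    (Finset.card_pair (Fin.ne_of_val_ne i.ne_add_one))

variable {n : ℕ}

theorem mem_adjPair {i : ℕ} {h : i + 1 < n} {a : Fin n} :
    a ∈ adjPair i h ↔ (a : ℕ) = i ∨ (a : ℕ) = i + 1 := by
  rw [← Set.powersetCard.mem_coe_iff, adjPair, Set.powersetCard.val_ofCard]
  simp only [Finset.mem_insert, Finset.mem_singleton, Fin.ext_iff]

theorem mem_adjSwap_smul {i : ℕ} {s : StrandPair n} {a : Fin n} :
    a ∈ adjSwap n i • s ↔ adjSwap n i a ∈ s := by
  rw [← Set.powersetCard.mem_coe_iff, Set.powersetCard.coe_smul, ← Finset.inv_smul_mem_iff,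
    inv_eq_of_mul_eq_one_left (adjSwap_mul_self n i), Set.powersetCard.mem_coe_iff,
    Equiv.Perm.smul_def]

theorem adjSwap_smul_adjPair_self {i : ℕ} (h : i + 1 < n) :
    adjSwap n i • adjPair i h = adjPair i h := by
  refine SetLike.ext fun a => ?_
  rw [mem_adjSwap_smul, mem_adjPair, mem_adjPair, coe_adjSwap_apply h]
  grind

theorem adjSwap_smul_adjPair_of_far {i j : ℕ} (hi : i + 1 < n) (hj : j + 1 < n)
    (hij : i + 2 ≤ j ∨ j + 2 ≤ i) : adjSwap n i • adjPair j hj = adjPair j hj := by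
  refine SetLike.ext fun a => ?_
  rw [mem_adjSwap_smul, mem_adjPair, mem_adjPair, coe_adjSwap_apply hi]
  grind

theorem adjSwap_smul_adjPair_succ {i : ℕ} (h : i + 1 + 1 < n) :
    adjSwap n i • adjPair (i + 1) h = adjSwap n (i + 1) • adjPair i (by omega) := by
  refine SetLike.ext fun a => ?_
  rw [mem_adjSwap_smul, mem_adjSwap_smul, mem_adjPair, mem_adjPair,
    coe_adjSwap_apply (by omega), coe_adjSwap_apply h]
  grind

/-- The target of the linking homomorphism: a permutation of the strands together with an integer
for each pair of strands, which counts the signed crossings of the two. -/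
abbrev LinkingGroup (n : ℕ) : Type := IntWreath (StrandPair n) (Equiv.Perm (Fin n))

/-- The images of the Artin generators in the linking group. -/
def linkingGen (n i : ℕ) : LinkingGroup n :=
  if h : i + 1 < n then IntWreath.single (adjPair i h) (adjSwap n i) else 1

theorem linkingGen_of_lt {i : ℕ} (h : i + 1 < n) :
    linkingGen n i = IntWreath.single (adjPair i h) (adjSwap n i) :=
  dif_pos h

theorem braidRelations_linkingGen (n : ℕ) : BraidRelations (linkingGen n) (n - 1) where
  comm i j hij hj := by
    have hi' : i + 1 < n := by omega
    have hj' : j + 1 < n := by omega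
    rw [linkingGen_of_lt hi', linkingGen_of_lt hj']
    exact IntWreath.single_comm ((braidRelations_adjSwap n).comm i j hij hj)
      (adjSwap_smul_adjPair_of_far hi' hj' (.inl hij))
      (adjSwap_smul_adjPair_of_far hj' hi' (.inr hij))
  braid i hi := by
    have hi' : i + 1 + 1 < n := by omega
    rw [linkingGen_of_lt hi', linkingGen_of_lt (by omega)]
    exact IntWreath.single_braid ((braidRelations_adjSwap n).braid i hi) (adjSwap_mul_self n i)
      (adjSwap_mul_self n (i + 1)) (adjSwap_smul_adjPair_succ hi')

/-- The homomorphism of the braid group that records the permutation and the signed number of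
crossings of each pair of strands. -/
def linkingHom (n : ℕ) : BraidGroup n →* LinkingGroup n :=
  braidLift (braidRelations_linkingGen n)

theorem linkingHom_artinGen {i : ℕ} (h : i + 1 < n) :
    linkingHom n (artinGen n i) = IntWreath.single (adjPair i h) (adjSwap n i) :=
  (braidLift_artinGen _ h).trans (linkingGen_of_lt h)

theorem rightHom_comp_linkingHom (n : ℕ) :
    SemidirectProduct.rightHom.comp (linkingHom n) = braidPerm n :=
  monoidHom_ext_artinGen fun i hi => by
    rw [MonoidHom.comp_apply, linkingHom_artinGen hi, braidPerm_artinGen]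
    rfl

theorem linkingHom_right (g : BraidGroup n) : (linkingHom n g).right = braidPerm n g :=
  DFunLike.congr_fun (rightHom_comp_linkingHom n) g

theorem commutator_pureBraidGroup_le_ker_linkingHom (n : ℕ) :
    ⁅pureBraidGroup n, pureBraidGroup n⁆ ≤ (linkingHom n).ker := by
  rw [Subgroup.commutator_le]
  intro x hx y hy
  rw [MonoidHom.mem_ker, map_commutatorElement, commutatorElement_eq_one_iff_commute]
  exact IntWreath.commute_of_right_eq_one ((linkingHom_right x).trans hx)
    ((linkingHom_right y).trans hy)

/-- The homomorphism induced by the linking homomorphism on `B_n / [P_n, P_n]`. -/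
def quotientLinking (n : ℕ) : BraidQuotient n →* LinkingGroup n :=
  QuotientGroup.lift _ (linkingHom n) (commutator_pureBraidGroup_le_ker_linkingHom n)

/-- The permutation induced by an element of `B_n / [P_n, P_n]`. -/
def quotientPerm (n : ℕ) : BraidQuotient n →* Equiv.Perm (Fin n) :=
  SemidirectProduct.rightHom.comp (quotientLinking n)

theorem quotientLinking_right (x : BraidQuotient n) :
    (quotientLinking n x).right = quotientPerm n x := rfl

theorem quotientPerm_mk (g : BraidGroup n) : quotientPerm n (QuotientGroup.mk g) = braidPerm n g :=
  linkingHom_right g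

theorem quotientPerm_surjective (n : ℕ) : Function.Surjective (quotientPerm n) := fun p => by
  obtain ⟨g, rfl⟩ := braidPerm_surjective n p
  exact ⟨_, quotientPerm_mk g⟩

/-- The images in `B_n / [P_n, P_n]` of the Artin generators, as a sequence with the junk value `1`
from the index `n - 1` on. -/
def artinClass (n i : ℕ) : BraidQuotient n := QuotientGroup.mk (artinGen n i)

theorem artinClass_coe (i : Fin (n - 1)) : artinClass n i = braidQuotientGen n i :=
  congrArg _ (artinGen_coe i)

theorem braidRelations_artinClass (n : ℕ) : BraidRelations (artinClass n) (n - 1) :=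
  (braidRelations_artinGen n).map (QuotientGroup.mk' _)

theorem quotientPerm_artinClass (n i : ℕ) : quotientPerm n (artinClass n i) = adjSwap n i :=
  (quotientPerm_mk _).trans (braidPerm_artinGen n i)

theorem quotientLinking_artinClass {i : ℕ} (h : i + 1 < n) :
    quotientLinking n (artinClass n i) = IntWreath.single (adjPair i h) (adjSwap n i) :=
  linkingHom_artinGen h

theorem initialClosure_artinClass (n : ℕ) : initialClosure (artinClass n) (n - 1) = ⊤ := by
  rw [← Subgroup.map_top_of_surjective (QuotientGroup.mk' ⁅pureBraidGroup n, pureBraidGroup n⁆)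
    (QuotientGroup.mk'_surjective _), ← initialClosure_artinGen, map_initialClosure]
  rfl

theorem commute_of_quotientPerm_eq_one {x y : BraidQuotient n}
    (hx : quotientPerm n x = 1) (hy : quotientPerm n y = 1) : Commute x y := by
  induction x using QuotientGroup.induction_on with | H x =>
  induction y using QuotientGroup.induction_on with | H y =>
  rw [quotientPerm_mk] at hx hy
  rw [← commutatorElement_eq_one_iff_commute]
  exact (QuotientGroup.eq_one_iff _).mpr (Subgroup.commutator_mem_commutator hx hy)

end Linking

/-! ### Injectivity of the linking homomorphism -/

section Injectivity

theorem isConj_artinClass {n i j : ℕ} (hij : i ≤ j) (hj : j + 1 < n) :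
    IsConj (artinClass n i) (artinClass n j) := by
  induction j, hij using Nat.le_induction with
  | base => exact IsConj.refl _
  | succ j _ ih =>
    refine (ih (by omega)).trans (isConj_iff.mpr ⟨artinClass n j * artinClass n (j + 1), ?_⟩)
    rw [mul_inv_eq_iff_eq_mul, ← (braidRelations_artinClass n).braid j (by omega), mul_assoc]

variable {k : ℕ}

/-- The square of the last Artin generator, that is, the full twist of the last two strands. -/
def lastTwist (k : ℕ) : BraidQuotient (k + 2) := artinClass (k + 2) k * artinClass (k + 2) k

/-- The pair of the last two strands. -/
def lastPair (k : ℕ) : StrandPair (k + 2) := adjPair k (Nat.lt_succ_self (k + 1))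

theorem quotientLinking_lastTwist (k : ℕ) : quotientLinking (k + 2) (lastTwist k) =
    SemidirectProduct.inl (Pi.mulSingle (lastPair k) (Multiplicative.ofAdd 2)) := by
  rw [lastTwist, map_mul, quotientLinking_artinClass (Nat.lt_succ_self (k + 1))]
  exact IntWreath.single_mul_self (adjSwap_mul_self _ _) (adjSwap_smul_adjPair_self _)

theorem quotientPerm_lastTwist (k : ℕ) : quotientPerm (k + 2) (lastTwist k) = 1 :=
  congrArg SemidirectProduct.right (quotientLinking_lastTwist k)

-- Modulo the conjugates of `σ_{k+1}²` the braid relations become the Coxeter relations.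
theorem normalClosure_lastTwist (k : ℕ) :
    Subgroup.normalClosure {lastTwist k} = (quotientPerm (k + 2)).ker := by
  set N := Subgroup.normalClosure {lastTwist k}
  have hN : N ≤ (quotientPerm (k + 2)).ker :=
    Subgroup.normalClosure_le_normal (by simpa using quotientPerm_lastTwist k)
  refine hN.antisymm fun x hx => ?_
  have hsq : ∀ i < k + 1, artinClass (k + 2) i * artinClass (k + 2) i ∈ N := fun i hi => by
    obtain ⟨u, hu⟩ := isConj_iff.mp
      (isConj_artinClass (Nat.lt_succ_iff.mp hi) (Nat.lt_succ_self (k + 1))).symm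
    rw [← hu, conj_mul]
    exact Subgroup.normalClosure_normal.conj_mem _
      (Subgroup.subset_normalClosure (Set.mem_singleton _)) u
  rw [← QuotientGroup.eq_one_iff]
  refine eq_one_of_mem_initialClosure (n := k + 2)
    (f := QuotientGroup.lift N (quotientPerm (k + 2)) hN)
    ((braidRelations_artinClass (k + 2)).map (QuotientGroup.mk' N))
    (fun i hi => (QuotientGroup.eq_one_iff _).mpr (hsq i hi))
    (fun i _ => quotientPerm_artinClass (k + 2) i) le_rfl ?_ hx
  rw [← map_initialClosure, initialClosure_artinClass]
  exact Subgroup.mem_map_of_mem _ (Subgroup.mem_top x)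

theorem mem_initialClosure_adjSwap {g : Equiv.Perm (Fin (k + 2))}
    (hlast : g ⟨k + 1, by omega⟩ = ⟨k + 1, by omega⟩) (hpenult : g ⟨k, by omega⟩ = ⟨k, by omega⟩) :
    g ∈ initialClosure (adjSwap (k + 2)) (k - 1) := by
  have hstep : ∀ j, (hj : j + 1 < k + 2) → g ⟨j + 1, hj⟩ = ⟨j + 1, hj⟩ →
      g ∈ initialClosure (adjSwap (k + 2)) (j + 1) → g ∈ initialClosure (adjSwap (k + 2)) j :=
    fun j hj hfix hg => mem_initialClosure_of_apply_eq (f := MonoidHom.id _)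
      (braidRelations_adjSwap _) (fun i _ => adjSwap_mul_self _ i) (fun _ _ => rfl) hj hg hfix
  have hk : g ∈ initialClosure (adjSwap (k + 2)) k :=
    hstep k (by omega) hlast ((initialClosure_adjSwap (k + 2)).ge (Subgroup.mem_top g))
  obtain _ | k := k
  · exact hk
  · exact hstep k (by omega) hpenult hk

theorem commute_lastTwist_of_fixes {x : BraidQuotient (k + 2)}
    (hlast : quotientPerm (k + 2) x ⟨k + 1, by omega⟩ = ⟨k + 1, by omega⟩)
    (hpenult : quotientPerm (k + 2) x ⟨k, by omega⟩ = ⟨k, by omega⟩) :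
    Commute x (lastTwist k) := by
  have hmem := mem_initialClosure_adjSwap hlast hpenult
  rw [← funext (quotientPerm_artinClass (k + 2)), ← map_initialClosure] at hmem
  obtain ⟨y, hy, hyx⟩ := hmem
  have hle : initialClosure (artinClass (k + 2)) (k - 1) ≤ Subgroup.centralizer {lastTwist k} := by
    rw [initialClosure, Subgroup.closure_le]
    rintro _ ⟨i, hi, rfl⟩
    rw [Set.mem_Iio] at hi
    have hcomm : Commute (artinClass (k + 2) i) (artinClass (k + 2) k) :=
      (braidRelations_artinClass (k + 2)).comm i k (by omega) (by omega)
    exact Subgroup.mem_centralizer_singleton_iff.mpr (hcomm.mul_right hcomm)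
  have hpure : Commute (y⁻¹ * x) (lastTwist k) := commute_of_quotientPerm_eq_one
    (by rw [map_mul, map_inv, hyx, inv_mul_cancel]) (quotientPerm_lastTwist k)
  have hycomm : Commute y (lastTwist k) := Subgroup.mem_centralizer_singleton_iff.mp (hle hy)
  simpa only [mul_inv_cancel_left] using hycomm.mul_left hpure

theorem commute_lastTwist {x : BraidQuotient (k + 2)}
    (hx : quotientPerm (k + 2) x • lastPair k = lastPair k) : Commute x (lastTwist k) := by
  have hmem : ∀ a, a ∈ lastPair k → (quotientPerm (k + 2) x a : Fin (k + 2)) ∈ lastPair k := by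
    intro a ha
    rw [← hx, ← Set.powersetCard.mem_coe_iff, Set.powersetCard.coe_smul]
    exact Finset.smul_mem_smul_finset ha
  simp only [lastPair, mem_adjPair] at hmem
  have hk := hmem ⟨k, by omega⟩ (.inl rfl)
  have hk' := hmem ⟨k + 1, by omega⟩ (.inr rfl)
  have hne : (quotientPerm (k + 2) x ⟨k, by omega⟩ : ℕ) ≠
      quotientPerm (k + 2) x ⟨k + 1, by omega⟩ :=
    Fin.val_ne_of_ne ((quotientPerm (k + 2) x).injective.ne (by simp))
  rcases hk with hk | hk
  · exact commute_lastTwist_of_fixes (Fin.ext (by grind)) (Fin.ext hk)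
  · have hgen : Commute (artinClass (k + 2) k) (lastTwist k) :=
      (Commute.refl _).mul_right (Commute.refl _)
    have hmul : Commute (artinClass (k + 2) k * x) (lastTwist k) := by
      apply commute_lastTwist_of_fixes <;>
      · rw [map_mul, quotientPerm_artinClass, Equiv.Perm.mul_apply, Fin.ext_iff,
          coe_adjSwap_apply (by omega)]
        grind
    simpa only [inv_mul_cancel_left] using hgen.inv_left.mul_left hmul

theorem exists_quotientPerm_smul_lastPair (s : StrandPair (k + 2)) :
    ∃ x, quotientPerm (k + 2) x • lastPair k = s := by
  obtain ⟨p, hp⟩ := Set.powersetCard.isPretransitive.exists_smul_eq (lastPair k) s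
  obtain ⟨x, rfl⟩ := quotientPerm_surjective _ p
  exact ⟨x, hp⟩

/-- The class in `B_n / [P_n, P_n]` of a full twist of the two strands of the pair `s`: a conjugate
of `lastTwist` by any element that moves the last two strands to `s`. -/
noncomputable def pairTwist (s : StrandPair (k + 2)) : BraidQuotient (k + 2) :=
  (exists_quotientPerm_smul_lastPair s).choose * lastTwist k *
    (exists_quotientPerm_smul_lastPair s).choose⁻¹

theorem conj_lastTwist (x : BraidQuotient (k + 2)) :
    x * lastTwist k * x⁻¹ = pairTwist (quotientPerm (k + 2) x • lastPair k) := by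
  have hex := exists_quotientPerm_smul_lastPair (quotientPerm (k + 2) x • lastPair k)
  have hspec := hex.choose_spec
  rw [pairTwist]
  set y := hex.choose
  have hcomm : Commute (y⁻¹ * x) (lastTwist k) := by
    apply commute_lastTwist
    rw [map_mul, mul_smul, ← hspec, map_inv, inv_smul_smul]
  calc x * lastTwist k * x⁻¹ = y * ((y⁻¹ * x) * lastTwist k) * x⁻¹ := by group
    _ = y * (lastTwist k * (y⁻¹ * x)) * x⁻¹ := by rw [hcomm.eq]
    _ = y * lastTwist k * y⁻¹ := by group

theorem quotientLinking_pairTwist (s : StrandPair (k + 2)) : quotientLinking (k + 2) (pairTwist s) =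
    SemidirectProduct.inl (Pi.mulSingle s (Multiplicative.ofAdd 2)) := by
  obtain ⟨x, rfl⟩ := exists_quotientPerm_smul_lastPair s
  rw [← conj_lastTwist, map_mul, map_mul, map_inv, quotientLinking_lastTwist,
    IntWreath.conj_inl_mulSingle, quotientLinking_right]

theorem quotientPerm_pairTwist (s : StrandPair (k + 2)) :
    quotientPerm (k + 2) (pairTwist s) = 1 :=
  congrArg SemidirectProduct.right (quotientLinking_pairTwist s)

theorem closure_range_pairTwist (k : ℕ) :
    Subgroup.closure (Set.range (pairTwist (k := k))) = (quotientPerm (k + 2)).ker := by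
  apply le_antisymm
  · rw [Subgroup.closure_le]
    rintro _ ⟨s, rfl⟩
    exact quotientPerm_pairTwist s
  · rw [← normalClosure_lastTwist, Subgroup.normalClosure]
    refine Subgroup.closure_mono fun x hx => ?_
    obtain ⟨_, rfl, hconj⟩ := Group.mem_conjugatesOfSet_iff.mp hx
    obtain ⟨u, rfl⟩ := isConj_iff.mp hconj
    exact ⟨_, (conj_lastTwist u).symm⟩

theorem pairwise_commute_zpowersHom_pairTwist (k : ℕ) :
    Pairwise fun s s' : StrandPair (k + 2) => ∀ x y : Multiplicative ℤ,
      Commute (zpowersHom _ (pairTwist s) x) (zpowersHom _ (pairTwist s') y) :=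
  fun s s' _ x y => commute_of_quotientPerm_eq_one
    (by simp [zpowersHom_apply, quotientPerm_pairTwist])
    (by simp [zpowersHom_apply, quotientPerm_pairTwist])

/-- The products of powers of the twists of pairs of strands. -/
noncomputable def twistHom (k : ℕ) :
    (StrandPair (k + 2) → Multiplicative ℤ) →* BraidQuotient (k + 2) :=
  MonoidHom.noncommPiCoprod (fun s => zpowersHom _ (pairTwist s))
    (pairwise_commute_zpowersHom_pairTwist k)

theorem twistHom_mulSingle (s : StrandPair (k + 2)) (z : Multiplicative ℤ) :
    twistHom k (Pi.mulSingle s z) = pairTwist s ^ Multiplicative.toAdd z :=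
  MonoidHom.noncommPiCoprod_mulSingle ..

theorem range_twistHom (k : ℕ) : (twistHom k).range = (quotientPerm (k + 2)).ker := by
  rw [twistHom, MonoidHom.noncommPiCoprod_range, ← closure_range_pairTwist,
    ← Set.iUnion_singleton_eq_range, Subgroup.closure_iUnion]
  simp only [← Subgroup.zpowers_eq_closure]
  rfl

theorem quotientLinking_twistHom (w : StrandPair (k + 2) → Multiplicative ℤ) :
    quotientLinking (k + 2) (twistHom k w) = SemidirectProduct.inl (w ^ 2) := by
  suffices (quotientLinking (k + 2)).comp (twistHom k) =
      SemidirectProduct.inl.comp (powMonoidHom 2) from DFunLike.congr_fun this w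
  refine MonoidHom.pi_ext fun s z => ?_
  rw [MonoidHom.comp_apply, twistHom_mulSingle, map_zpow, quotientLinking_pairTwist, ← map_zpow,
    MonoidHom.comp_apply, powMonoidHom_apply, ← Pi.mulSingle_zpow, ← Pi.mulSingle_pow]
  congr 2
  exact Multiplicative.toAdd.injective (by simp [mul_comm])

theorem quotientLinking_injective (n : ℕ) : Function.Injective (quotientLinking n) := by
  refine (injective_iff_map_eq_one _).mpr fun x hx => ?_
  have htop := (initialClosure_artinClass n).ge (Subgroup.mem_top x)
  obtain _ | _ | k := n
  · exact (initialClosure_zero _).le htop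
  · exact (initialClosure_zero _).le htop
  · have hpure : x ∈ (quotientPerm (k + 2)).ker := congrArg SemidirectProduct.right hx
    rw [← range_twistHom] at hpure
    obtain ⟨w, rfl⟩ := hpure
    rw [quotientLinking_twistHom, map_eq_one_iff _ SemidirectProduct.inl_injective,
      pow_eq_one_iff_left two_ne_zero] at hx
    rw [hx, map_one]

end Injectivity

/-! ### Crystallographic groups of affine permutations -/

section Holonomy

theorem ker_conjAct {N E G : Type*} [Group N] [Group E] [Group G]
    (S : GroupExtension N E G) : S.conjAct.ker = Subgroup.centralizer S.rightHom.ker := by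
  ext g
  rw [MonoidHom.mem_ker, Subgroup.mem_centralizer_iff, ← S.range_inl_eq_ker_rightHom,
    MulEquiv.ext_iff]
  simp only [SetLike.mem_coe, MonoidHom.mem_range, forall_exists_index, forall_apply_eq_imp_iff,
    MulAut.one_apply, ← S.inl_injective.eq_iff, S.inl_conjAct_comm, mul_inv_eq_iff_eq_mul]
  exact forall_congr' fun _ => eq_comm

theorem hasHolonomyGroup_of_centralizer_ker_le {d : ℕ} {Φ Γ : Type*} [Group Φ] [Group Γ] [Finite Φ]
    {φ : Γ →* Φ} (hφ : Function.Surjective φ) (e : φ.ker ≃* Multiplicative (Fin d → ℤ))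
    (hC : Subgroup.centralizer φ.ker ≤ φ.ker) : HasHolonomyGroup d Φ Γ := by
  let S : GroupExtension (Multiplicative (Fin d → ℤ)) Γ Φ :=
    { inl := φ.ker.subtype.comp e.symm
      rightHom := φ
      inl_injective := φ.ker.subtype_injective.comp e.symm.injective
      range_inl_eq_ker_rightHom := by
        rw [MonoidHom.range_comp, MonoidHom.range_eq_top.mpr e.symm.surjective,
          ← MonoidHom.range_eq_map, Subgroup.range_subtype]
      rightHom_surjective := hφ }
  have hcomm : φ.ker ≤ Subgroup.centralizer φ.ker := fun g hg => by
    refine Subgroup.mem_centralizer_iff.mpr fun h hh => ?_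
    exact congrArg Subtype.val (e.injective
      ((map_mul e _ _).trans ((mul_comm _ _).trans (map_mul e ⟨g, hg⟩ ⟨h, hh⟩).symm)))
  have hker : S.conjAct.ker = φ.ker := (ker_conjAct S).trans (hC.antisymm hcomm)
  obtain ⟨Θ, hΘ⟩ : ∃ Θ : Φ →* MulAut (Multiplicative (Fin d → ℤ)), ∀ g, Θ (φ g) = S.conjAct g :=
    ⟨φ.liftOfSurjective hφ ⟨S.conjAct, hker.ge⟩, φ.liftOfRightInverse_comp_apply _ _ _⟩
  refine ⟨inferInstance, S, Θ, fun g x => ?_, (injective_iff_map_eq_one Θ).mpr fun a ha => ?_⟩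
  · rw [← S.inl_conjAct_comm, ← hΘ]
  · obtain ⟨g, rfl⟩ := hφ a
    exact hker.le ((hΘ g).symm.trans ha)

theorem finrank_eq_of_smul_mem {R M : Type*} [CommRing R] [IsDomain R]
    [AddCommGroup M] [Module R M] [Module.IsTorsionFree R M] [IsNoetherian R M]
    {L : Submodule R M} {r : R} (hr : r ≠ 0) (hL : ∀ x, r • x ∈ L) :
    Module.finrank R L = Module.finrank R M :=
  (Submodule.finrank_le L).antisymm <| LinearMap.finrank_le_finrank_of_injective
    (f := (LinearMap.lsmul R M r).codRestrict L hL) fun _ _ h =>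
      smul_right_injective M hr (congrArg Subtype.val h)

theorem nonempty_mulEquiv_of_pow_mem_range {A I : Type*} [Group A] [Finite I]
    {f : A →* I → Multiplicative ℤ} (hf : Function.Injective f) {N : ℕ} (hN : N ≠ 0)
    (hpow : ∀ w, w ^ N ∈ f.range) : Nonempty (A ≃* Multiplicative (Fin (Nat.card I) → ℤ)) := by
  cases nonempty_fintype I
  let h : Additive A →+ I → ℤ := MonoidHom.toAdditiveLeft
    ((MulEquiv.funMultiplicative I ℤ).symm.toMonoidHom.comp f)
  have hh : Function.Injective h := (MulEquiv.funMultiplicative I ℤ).symm.injective.comp hf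
  have hrank : Module.finrank ℤ h.range.toIntSubmodule = Nat.card I := by
    rw [finrank_eq_of_smul_mem (Nat.cast_ne_zero.mpr hN) fun w => ?_,
      Module.finrank_fintype_fun_eq_card, Nat.card_eq_fintype_card]
    obtain ⟨a, ha⟩ := hpow fun i => Multiplicative.ofAdd (w i)
    refine ⟨Additive.ofMul a, funext fun i => ?_⟩
    simp [h, ha]
  exact ⟨AddEquiv.toMultiplicativeRight ((AddMonoidHom.ofInjective hh).trans
    (Module.finBasisOfFinrankEq ℤ h.range.toIntSubmodule hrank).equivFun.toAddEquiv)⟩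

end Holonomy

section Motions

variable {d : ℕ}

instance compactSpace_orthogonalGroup (d : ℕ) :
    CompactSpace (Matrix.orthogonalGroup (Fin d) ℝ) := by
  refine isCompact_iff_compactSpace.mp (IsCompact.of_isClosed_subset
    (X := Matrix (Fin d) (Fin d) ℝ) (isCompact_univ_pi fun _ => isCompact_univ_pi fun _ =>
      isCompact_Icc (a := (-1 : ℝ)) (b := 1)) isClosed_unitary fun A hA i _ j _ => ?_)
  exact abs_le.mp (entry_norm_bound_of_unitary hA i j)

theorem isEmbedding_euclideanMotion (d : ℕ) : Topology.IsEmbedding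
    (fun g => (Multiplicative.toAdd g.left, g.right) :
      EuclideanMotion d → (Fin d → ℝ) × Matrix.orthogonalGroup (Fin d) ℝ) :=
  ⟨⟨rfl⟩, fun _ _ h => SemidirectProduct.ext (congrArg Prod.fst h) (congrArg Prod.snd h)⟩

theorem isEmbedding_intCast (d : ℕ) : Topology.IsEmbedding
    (fun p => (fun k => (p.1 k : ℝ), Matrix.of fun i j => (p.2 i j : ℝ)) :
      (Fin d → ℤ) × (Fin d → Fin d → ℤ) → (Fin d → ℝ) × Matrix (Fin d) (Fin d) ℝ) :=
  have hint := Int.isClosedEmbedding_coe_real.isEmbedding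
  (Topology.IsEmbedding.piMap fun _ => hint).prodMap
    (Topology.IsEmbedding.piMap fun _ => Topology.IsEmbedding.piMap fun _ => hint)

theorem discreteTopology_of_integral {C : Subgroup (EuclideanMotion d)}
    (hC : ∀ g ∈ C, ∃ (v : Fin d → ℤ) (A : Fin d → Fin d → ℤ),
      (fun k => (v k : ℝ)) = Multiplicative.toAdd g.left ∧
        (Matrix.of fun i j => (A i j : ℝ)) = g.right.1) : DiscreteTopology C := by
  have hemb : Topology.IsEmbedding fun g : C =>
      (Multiplicative.toAdd g.1.left, (g.1.right.1 : Matrix (Fin d) (Fin d) ℝ)) :=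
    ((Topology.IsEmbedding.id.prodMap Topology.IsEmbedding.subtypeVal).comp
      (isEmbedding_euclideanMotion d)).comp Topology.IsEmbedding.subtypeVal
  choose v A hv hA using fun g : C => hC g.1 g.2
  simp only [← hv, ← hA] at hemb
  exact ((isEmbedding_intCast d).of_comp_iff (f := fun g => (v g, A g)).mp hemb).discreteTopology

theorem compactSpace_quotient_of_translations {C : Subgroup (EuclideanMotion d)} {N : ℝ}
    (hN : 0 < N) (hC : ∀ w : Fin d → ℤ,
      SemidirectProduct.inl (Multiplicative.ofAdd fun k => N * w k) ∈ C) :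
    CompactSpace (EuclideanMotion d ⧸ C) := by
  let motion : (Fin d → ℝ) × Matrix.orthogonalGroup (Fin d) ℝ → EuclideanMotion d := fun p =>
    SemidirectProduct.inr p.2 * SemidirectProduct.inl (Multiplicative.ofAdd p.1)
  have hcont : Continuous motion := by
    rw [(isEmbedding_euclideanMotion d).continuous_iff]
    have hprod : Continuous fun p : (Fin d → ℝ) × Matrix.orthogonalGroup (Fin d) ℝ =>
      (p.2.1.mulVec p.1, p.2) := by fun_prop
    exact hprod.congr fun p => Prod.ext (zero_add _).symm (mul_one _).symm
  have hcompact : IsCompact ((Set.univ.pi fun _ : Fin d => Set.Icc (0 : ℝ) N) ×ˢ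
      (Set.univ : Set (Matrix.orthogonalGroup (Fin d) ℝ))) :=
    (isCompact_univ_pi fun _ => isCompact_Icc).prod isCompact_univ
  refine ⟨(hcompact.image (continuous_quotient_mk'.comp hcont)).of_isClosed_subset
    isClosed_univ fun x _ => ?_⟩
  induction x using QuotientGroup.induction_on with | H g =>
  obtain ⟨u, hu⟩ : ∃ u, motion (u, g.right) = g :=
    ⟨Multiplicative.toAdd ((orthogonalAction d g.right)⁻¹ g.left),
      SemidirectProduct.ext (by simp [motion]) (by simp [motion])⟩
  let w : Fin d → ℤ := fun k => -⌊u k / N⌋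
  have hfract : ∀ k, u k + N * w k = N * Int.fract (u k / N) := fun k => by
    simp only [w, Int.fract]
    push_cast
    field_simp
    ring
  refine ⟨(u + fun k => N * w k, g.right), ⟨fun k _ => ?_, Set.mem_univ _⟩, ?_⟩
  · refine Set.mem_of_eq_of_mem (hfract k) ?_
    exact ⟨mul_nonneg hN.le (Int.fract_nonneg _),
      mul_le_of_le_one_right hN.le (Int.fract_lt_one _).le⟩
  · have hmul : motion (u + fun k => N * w k, g.right) =
        g * SemidirectProduct.inl (Multiplicative.ofAdd fun k => N * w k) := by
      rw [← hu]
      simp only [motion, ofAdd_add, map_mul, mul_assoc]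
      simp
    exact (congrArg QuotientGroup.mk hmul).trans (QuotientGroup.mk_mul_of_mem g (hC w))

end Motions

section LatticeRepresentation

/-- The orthogonal matrix that permutes the coordinates. -/
noncomputable def orthogonalPerm (d : ℕ) :
    Equiv.Perm (Fin d) →* Matrix.orthogonalGroup (Fin d) ℝ :=
  Matrix.permMatrixHom.codRestrict (Matrix.orthogonalGroup (Fin d) ℝ) fun p => by
    rw [Matrix.mem_orthogonalGroup_iff, Matrix.permMatrixHom_apply, Matrix.transpose_permMatrix,
      ← Matrix.permMatrix_mul, inv_mul_cancel, Matrix.permMatrix_one]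

theorem coe_orthogonalPerm {d : ℕ} (p : Equiv.Perm (Fin d)) :
    (orthogonalPerm d p : Matrix (Fin d) (Fin d) ℝ) = p⁻¹.permMatrix ℝ := rfl

theorem orthogonalAction_orthogonalPerm {d : ℕ} (p : Equiv.Perm (Fin d)) (v : Fin d → ℝ) :
    orthogonalAction d (orthogonalPerm d p) (Multiplicative.ofAdd v) =
      Multiplicative.ofAdd (v ∘ ⇑p⁻¹) :=
  congrArg Multiplicative.ofAdd (Matrix.permMatrix_mulVec p⁻¹)

theorem orthogonalPerm_injective (d : ℕ) : Function.Injective (orthogonalPerm d) := by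
  refine (injective_iff_map_eq_one _).mpr fun p hp => inv_eq_one.mp (Equiv.ext fun k => ?_)
  have hval := orthogonalAction_orthogonalPerm p fun i => ((i : ℕ) : ℝ)
  rw [hp, map_one, MulAut.one_apply, Equiv.apply_eq_iff_eq] at hval
  exact Fin.ext (Nat.cast_injective (congrFun hval k).symm)

variable {I Φ Γ : Type*} [Group Φ] [Group Γ] {d : ℕ}

/-- The action of `ℤ^I ⋊ Perm I` on Euclidean space by translations and permutations of the
coordinates, for a numbering `e` of the coordinates. -/
noncomputable def motionHom (e : I ≃ Fin d) : IntWreath I (Equiv.Perm I) →* EuclideanMotion d :=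
  SemidirectProduct.map
    { toFun w := Multiplicative.ofAdd fun k => ((w (e.symm k)).toAdd : ℝ)
      map_one' := by ext; simp
      map_mul' v w := by ext; simp }
    ((orthogonalPerm d).comp e.permCongrHom) fun p => MonoidHom.ext fun w => by
      refine ((orthogonalAction_orthogonalPerm (e.permCongrHom p) fun k =>
        ((w (e.symm k)).toAdd : ℝ)).trans (congrArg Multiplicative.ofAdd ?_)).symm
      rw [← map_inv]
      exact funext fun k => congrArg (fun i => ((w i).toAdd : ℝ)) (e.symm_apply_apply _)

theorem toAdd_motionHom_left (e : I ≃ Fin d) (x : IntWreath I (Equiv.Perm I)) :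
    Multiplicative.toAdd (motionHom e x).left =
      fun k => ((x.left (e.symm k)).toAdd : ℝ) := rfl

theorem motionHom_right (e : I ≃ Fin d) (x : IntWreath I (Equiv.Perm I)) :
    (motionHom e x).right = orthogonalPerm d (e.permCongrHom x.right) := rfl

theorem motionHom_injective (e : I ≃ Fin d) : Function.Injective (motionHom e) := fun x y h => by
  refine SemidirectProduct.ext (funext fun i => ?_) ?_
  · have hi := congrFun (congrArg (fun g => Multiplicative.toAdd g.left) h) (e i)
    simpa [toAdd_motionHom_left] using hi
  · exact e.permCongrHom.injective (orthogonalPerm_injective d (congrArg SemidirectProduct.right h))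

/-- A group `Γ` of affine permutations of `ℤ^I` that contains a lattice of translations of finite
index, together with the quotient `Φ` by its translations. -/
structure IsLatticeRepresentation (ρ : Γ →* IntWreath I (Equiv.Perm I)) (φ : Γ →* Φ) : Prop where
  injective : Function.Injective ρ
  surjective : Function.Surjective φ
  ker_eq : φ.ker = (SemidirectProduct.rightHom.comp ρ).ker
  exists_pow_mem_range : ∃ N : ℕ, N ≠ 0 ∧
    ∀ w : I → Multiplicative ℤ, SemidirectProduct.inl (w ^ N) ∈ ρ.range

namespace IsLatticeRepresentation

variable {ρ : Γ →* IntWreath I (Equiv.Perm I)} {φ : Γ →* Φ}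

theorem mem_ker_iff (h : IsLatticeRepresentation ρ φ) {g : Γ} : g ∈ φ.ker ↔ (ρ g).right = 1 := by
  rw [h.ker_eq]; rfl

theorem isCrystallographic (h : IsLatticeRepresentation ρ φ) (e : I ≃ Fin d) :
    IsCrystallographic d Γ := by
  refine ⟨((motionHom e).comp ρ).range, discreteTopology_of_integral ?_, ?_,
    ⟨MonoidHom.ofInjective ((motionHom_injective e).comp h.injective)⟩⟩
  · rintro _ ⟨g, rfl⟩
    refine ⟨fun k => ((ρ g).left (e.symm k)).toAdd,
      (e.permCongrHom (ρ g).right)⁻¹.permMatrix ℤ, rfl, ?_⟩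
    rw [MonoidHom.comp_apply, motionHom_right, coe_orthogonalPerm]
    ext i j
    simp [Equiv.Perm.permMatrix, PEquiv.toMatrix_apply]
  · obtain ⟨N, hN, hpow⟩ := h.exists_pow_mem_range
    refine compactSpace_quotient_of_translations (N := N) (by positivity) fun w => ?_
    obtain ⟨g, hg⟩ := hpow fun i => Multiplicative.ofAdd (w (e i))
    refine ⟨g, SemidirectProduct.ext ?_ ?_⟩
    · refine Multiplicative.toAdd.injective ?_
      rw [MonoidHom.comp_apply, toAdd_motionHom_left, hg, SemidirectProduct.left_inl]
      simp
    · rw [MonoidHom.comp_apply, motionHom_right, hg, SemidirectProduct.right_inl, map_one, map_one,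
        SemidirectProduct.right_inl]

theorem centralizer_ker_le (h : IsLatticeRepresentation ρ φ) :
    Subgroup.centralizer φ.ker ≤ φ.ker := fun x hx => by
  classical
  obtain ⟨N, hN, hpow⟩ := h.exists_pow_mem_range
  refine h.mem_ker_iff.mpr (Equiv.ext fun s => ?_)
  obtain ⟨g, hg⟩ := hpow (Pi.mulSingle s (Multiplicative.ofAdd 1))
  have hconj : ρ x * ρ g * (ρ x)⁻¹ = ρ g := by
    rw [mul_inv_eq_iff_eq_mul, ← map_mul, ← map_mul]
    exact congrArg ρ (Subgroup.mem_centralizer_iff.mp hx g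
      (h.mem_ker_iff.mpr (congrArg (·.right) hg))).symm
  rw [hg, ← Pi.mulSingle_pow, IntWreath.conj_inl_mulSingle,
    SemidirectProduct.inl_injective.eq_iff] at hconj
  by_contra hne
  rw [Equiv.Perm.one_apply, ← Equiv.Perm.smul_def] at hne
  have hval := congrFun hconj s
  rw [Pi.mulSingle_eq_same, Pi.mulSingle_eq_of_ne (Ne.symm hne), eq_comm,
    pow_eq_one_iff_left hN] at hval
  exact one_ne_zero (ofAdd_eq_one.mp hval)

theorem nonempty_ker_mulEquiv [Finite I] (h : IsLatticeRepresentation ρ φ) :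
    Nonempty (φ.ker ≃* Multiplicative (Fin (Nat.card I) → ℤ)) := by
  let translation : φ.ker →* I → Multiplicative ℤ := MonoidHom.mk' (fun g => (ρ g).left)
    fun g g' => by
      rw [Subgroup.coe_mul, map_mul, SemidirectProduct.mul_left, h.mem_ker_iff.mp g.2, map_one,
        MulAut.one_apply]
  obtain ⟨N, hN, hpow⟩ := h.exists_pow_mem_range
  refine nonempty_mulEquiv_of_pow_mem_range (f := translation) (fun g g' hgg' => ?_) hN fun w => ?_
  · exact Subtype.ext (h.injective (SemidirectProduct.ext hgg'
      ((h.mem_ker_iff.mp g.2).trans (h.mem_ker_iff.mp g'.2).symm)))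
  · obtain ⟨g, hg⟩ := hpow w
    exact ⟨⟨g, h.mem_ker_iff.mpr (congrArg (·.right) hg)⟩, congrArg (·.left) hg⟩

theorem isBieberbach [Finite I] [Finite Φ] (h : IsLatticeRepresentation ρ φ)
    (htf : ∀ g : Γ, IsOfFinOrder g → g = 1) : IsBieberbach (Nat.card I) Φ Γ where
  crystallographic := h.isCrystallographic (Finite.equivFin I)
  torsionFree := htf
  holonomy := h.nonempty_ker_mulEquiv.elim fun e =>
    hasHolonomyGroup_of_centralizer_ker_le h.surjective e h.centralizer_ker_le

end IsLatticeRepresentation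

end LatticeRepresentation

section Products

variable {ι : Type*} {I Φ Γ : ι → Type*} [∀ i, Group (Φ i)] [∀ i, Group (Γ i)]

/-- A product of groups of affine permutations acts on the lattice of the disjoint union of the
index sets. -/
def IntWreath.sigmaHom (I : ι → Type*) : (∀ i, IntWreath (I i) (Equiv.Perm (I i))) →*
    IntWreath (Σ i, I i) (Equiv.Perm (Σ i, I i)) where
  toFun x := ⟨fun s => (x s.1).left s.2, Equiv.Perm.sigmaCongrRightHom I fun i => (x i).right⟩
  map_one' := SemidirectProduct.ext rfl (map_one (Equiv.Perm.sigmaCongrRightHom I))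
  map_mul' _ _ := SemidirectProduct.ext rfl (map_mul (Equiv.Perm.sigmaCongrRightHom I) _ _)

theorem IntWreath.sigmaHom_right (x : ∀ i, IntWreath (I i) (Equiv.Perm (I i))) :
    (IntWreath.sigmaHom I x).right = Equiv.Perm.sigmaCongrRightHom I fun i => (x i).right := rfl

theorem IntWreath.sigmaHom_injective (I : ι → Type*) :
    Function.Injective (IntWreath.sigmaHom I) := fun _ _ h => funext fun i =>
  SemidirectProduct.ext
    (funext fun s => congrFun (congrArg SemidirectProduct.left h) ⟨i, s⟩)
    (congrFun (Equiv.Perm.sigmaCongrRightHom_injective (congrArg SemidirectProduct.right h)) i)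

theorem IsLatticeRepresentation.pi [Finite ι] {ρ : ∀ i, Γ i →* IntWreath (I i) (Equiv.Perm (I i))}
    {φ : ∀ i, Γ i →* Φ i} (h : ∀ i, IsLatticeRepresentation (ρ i) (φ i)) :
    IsLatticeRepresentation ((IntWreath.sigmaHom I).comp (MonoidHom.piMap ρ)) (MonoidHom.piMap φ)
    where
  injective := (IntWreath.sigmaHom_injective I).comp
    (Function.Injective.piMap fun i => (h i).injective)
  surjective := Function.Surjective.piMap fun i => (h i).surjective
  ker_eq := by
    ext g
    have hperm : (IntWreath.sigmaHom I (MonoidHom.piMap ρ g)).right = 1 ↔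
        ∀ i, (ρ i (g i)).right = 1 := by
      rw [IntWreath.sigmaHom_right, map_eq_one_iff _ Equiv.Perm.sigmaCongrRightHom_injective]
      exact funext_iff
    refine Iff.trans ?_ hperm.symm
    simp only [← (h _).mem_ker_iff]
    exact funext_iff
  exists_pow_mem_range := by
    have := Fintype.ofFinite ι
    choose N hN hpow using fun i => (h i).exists_pow_mem_range
    refine ⟨∏ i, N i, Finset.prod_ne_zero_iff.mpr fun i _ => hN i, fun w => ?_⟩
    have hdvd : ∀ i, ∃ c, ∏ j, N j = c * N i := fun i =>
      exists_eq_mul_left_of_dvd (Finset.dvd_prod_of_mem N (Finset.mem_univ i))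
    choose c hc using hdvd
    choose g hg using fun i => hpow i fun s => w ⟨i, s⟩ ^ c i
    refine ⟨g, SemidirectProduct.ext (funext fun ⟨i, s⟩ => ?_) ?_⟩
    · rw [SemidirectProduct.left_inl, Pi.pow_apply, hc i, pow_mul]
      exact congrFun (congrArg SemidirectProduct.left (hg i)) s
    · have hone : (fun i => (ρ i (g i)).right) = 1 :=
        funext fun i => congrArg SemidirectProduct.right (hg i)
      rw [MonoidHom.comp_apply, IntWreath.sigmaHom_right]
      exact (congrArg _ hone).trans (map_one _)

theorem IsLatticeRepresentation.congr {I Φ Φ' Γ Γ' : Type*} [Group Φ] [Group Φ'] [Group Γ]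
    [Group Γ'] {ρ : Γ →* IntWreath I (Equiv.Perm I)} {φ : Γ →* Φ}
    (h : IsLatticeRepresentation ρ φ) (e : Γ' ≃* Γ) (f : Φ ≃* Φ') :
    IsLatticeRepresentation (ρ.comp e.toMonoidHom)
      (f.toMonoidHom.comp (φ.comp e.toMonoidHom)) where
  injective := h.injective.comp e.injective
  surjective := f.surjective.comp (h.surjective.comp e.surjective)
  ker_eq := by
    ext g
    exact (map_eq_one_iff f f.injective).trans h.mem_ker_iff
  exists_pow_mem_range := by
    rw [MonoidHom.range_comp, MonoidHom.range_eq_top.mpr e.surjective, ← MonoidHom.range_eq_map]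
    exact h.exists_pow_mem_range

end Products

/-! ### Subgroups with cyclic holonomy -/

section Cyclic

variable {n : ℕ}

/-- The action of the linking group on the lattice of integral functions on the pairs of strands. -/
def pairAction (n : ℕ) : LinkingGroup n →* IntWreath (StrandPair n) (Equiv.Perm (StrandPair n)) :=
  SemidirectProduct.map (MonoidHom.id _) (MulAction.toPermHom _ _) fun _ => rfl

theorem pairAction_right_eq_one_iff (hn : 3 ≤ n) {x : LinkingGroup n} :
    (pairAction n x).right = 1 ↔ x.right = 1 := by
  have : FaithfulSMul (Equiv.Perm (Fin n)) (StrandPair n) :=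
    Set.powersetCard.faithfulSMul one_le_two <| by
      rw [ENat.card_eq_coe_fintype_card, Fintype.card_fin]
      exact_mod_cast hn
  exact map_eq_one_iff _ MulAction.toPerm_injective

theorem pairAction_injective (hn : 3 ≤ n) : Function.Injective (pairAction n) :=
  (injective_iff_map_eq_one _).mpr fun x hx =>
    SemidirectProduct.ext (congrArg SemidirectProduct.left hx : x.left = 1)
      ((pairAction_right_eq_one_iff hn).mp (congrArg SemidirectProduct.right hx))

/-- The exponent sum of an element of `B_n / [P_n, P_n]`, modulo `n`. -/
def residueExponent (n : ℕ) : BraidQuotient n →* Multiplicative (ZMod n) :=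
  (AddMonoidHom.toMultiplicative (Int.castAddHom (ZMod n))).comp
    (IntWreath.exponentSum.comp (quotientLinking n))

theorem residueExponent_artinClass {i : ℕ} (h : i + 1 < n) :
    residueExponent n (artinClass n i) = Multiplicative.ofAdd 1 := by
  rw [residueExponent, MonoidHom.comp_apply, MonoidHom.comp_apply, quotientLinking_artinClass h,
    IntWreath.exponentSum_single]
  exact congrArg Multiplicative.ofAdd Int.cast_one

theorem residueExponent_descProd {d : ℕ} (h : d ≤ n - 1) :
    residueExponent n (descProd (artinClass n) 0 d) = Multiplicative.ofAdd (d : ZMod n) := by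
  induction d with
  | zero => rw [Nat.cast_zero, ofAdd_zero]; exact map_one _
  | succ d ih =>
    rw [descProd, map_mul, ih (by omega), residueExponent_artinClass (by omega), ← ofAdd_add,
      add_comm, Nat.cast_succ]

theorem residueExponent_of_quotientLinking_eq_inl_pow {g : BraidQuotient n}
    {w : StrandPair n → Multiplicative ℤ}
    (hg : quotientLinking n g = SemidirectProduct.inl (w ^ n)) :
    residueExponent n g = 1 := by
  rw [residueExponent, MonoidHom.comp_apply, MonoidHom.comp_apply, hg, map_pow, map_pow, map_pow]
  exact ZModModule.char_nsmul_eq_zero n (G := ZMod n) _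

theorem residueExponent_eq_one_of_isOfFinOrder {g : BraidQuotient n} (hg : IsOfFinOrder g) :
    residueExponent n g = 1 := by
  have hsum : IntWreath.exponentSum (quotientLinking n g) = 1 :=
    (MonoidHom.isOfFinOrder _ (MonoidHom.isOfFinOrder _ hg)).eq_one'
  rw [residueExponent, MonoidHom.comp_apply, MonoidHom.comp_apply, hsum, map_one]

/-- The class of the braid `σ_{n-1} ⋯ σ_1`, which rotates the strands. -/
def rotationClass (n : ℕ) : BraidQuotient n := descProd (artinClass n) 0 (n - 1)

theorem quotientPerm_rotationClass (hn : n ≠ 0) :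
    quotientPerm n (rotationClass n) = (finRotate n)⁻¹ := by
  obtain ⟨n, rfl⟩ := Nat.exists_eq_succ_of_ne_zero hn
  rw [eq_inv_iff_mul_eq_one]
  ext a
  simp only [rotationClass, map_descProd, quotientPerm_artinClass]
  rw [Equiv.Perm.mul_apply]
  refine (coe_descProd_adjSwap_apply (by omega) _).trans ?_
  rw [coe_finRotate, Equiv.Perm.one_apply]
  grind [Fin.ext_iff]

theorem orderOf_quotientPerm_rotationClass (hn : 2 ≤ n) :
    orderOf (quotientPerm n (rotationClass n)) = n := by
  rw [quotientPerm_rotationClass (by omega), orderOf_inv, (isCycle_finRotate_of_le hn).orderOf,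
    support_finRotate_of_le hn, Finset.card_univ, Fintype.card_fin]

theorem residueExponent_rotationClass (hn : n ≠ 0) :
    residueExponent n (rotationClass n) = (Multiplicative.ofAdd 1)⁻¹ := by
  rw [rotationClass, residueExponent_descProd le_rfl, Nat.cast_pred (by omega), ZMod.natCast_self,
    zero_sub, ofAdd_neg]

theorem orderOf_residueExponent_rotationClass (hn : n ≠ 0) :
    orderOf (residueExponent n (rotationClass n)) = n := by
  rw [residueExponent_rotationClass hn, orderOf_inv, orderOf_ofAdd_eq_addOrderOf,
    ZMod.addOrderOf_one]

theorem fst_eq_one_iff_of_mem_zpowers {G H : Type*} [Group G] [Group H] {x y : G × H}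
    (hx : orderOf x.1 = orderOf x.2) (hy : y ∈ Subgroup.zpowers x) : y.1 = 1 ↔ y.2 = 1 := by
  obtain ⟨j, rfl⟩ := hy
  change x.1 ^ j = 1 ↔ x.2 ^ j = 1
  rw [← orderOf_dvd_iff_zpow_eq_one, ← orderOf_dvd_iff_zpow_eq_one, hx]

/-- The elements of `B_n / [P_n, P_n]` that have the permutation and the residue of the exponent
sum of one and the same power of the rotation. The two determine each other, so that only the
translations have exponent sum divisible by `n`. -/
def cyclicSubgroup (n : ℕ) : Subgroup (BraidQuotient n) :=
  (Subgroup.zpowers ((quotientPerm n).prod (residueExponent n) (rotationClass n))).comap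
    ((quotientPerm n).prod (residueExponent n))

theorem rotationClass_mem_cyclicSubgroup (n : ℕ) : rotationClass n ∈ cyclicSubgroup n :=
  Subgroup.mem_zpowers _

theorem quotientPerm_eq_one_iff (hn : 2 ≤ n) {g : BraidQuotient n} (hg : g ∈ cyclicSubgroup n) :
    quotientPerm n g = 1 ↔ residueExponent n g = 1 :=
  fst_eq_one_iff_of_mem_zpowers ((orderOf_quotientPerm_rotationClass hn).trans
    (orderOf_residueExponent_rotationClass (by omega)).symm) hg

theorem eq_one_of_isOfFinOrder_of_mem_cyclicSubgroup (hn : 2 ≤ n) {g : BraidQuotient n}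
    (hg : g ∈ cyclicSubgroup n) (hfin : IsOfFinOrder g) : g = 1 := by
  have hperm := (quotientPerm_eq_one_iff hn hg).mpr (residueExponent_eq_one_of_isOfFinOrder hfin)
  exact (map_eq_one_iff _ (quotientLinking_injective n)).mp
    (IntWreath.eq_one_of_isOfFinOrder (MonoidHom.isOfFinOrder _ hfin) hperm)

theorem surjective_residueExponent_cyclicSubgroup (hn : n ≠ 0) :
    Function.Surjective ((residueExponent n).comp (cyclicSubgroup n).subtype) := fun x => by
  obtain ⟨j, hj⟩ := ZMod.intCast_surjective x.toAdd
  refine ⟨⟨rotationClass n, rotationClass_mem_cyclicSubgroup n⟩ ^ (-j), ?_⟩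
  rw [map_zpow, MonoidHom.comp_apply, Subgroup.subtype_apply, residueExponent_rotationClass hn,
    inv_zpow', neg_neg, ← ofAdd_zsmul, zsmul_one, hj, ofAdd_toAdd]

theorem isLatticeRepresentation_cyclicSubgroup (hn : 3 ≤ n) :
    IsLatticeRepresentation
      ((pairAction n).comp ((quotientLinking n).comp (cyclicSubgroup n).subtype))
      ((residueExponent n).comp (cyclicSubgroup n).subtype) where
  injective := (pairAction_injective hn).comp
    ((quotientLinking_injective n).comp Subtype.val_injective)
  surjective := surjective_residueExponent_cyclicSubgroup (by omega)
  ker_eq := by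
    ext g
    exact (quotientPerm_eq_one_iff (by omega) g.2).symm.trans (pairAction_right_eq_one_iff hn).symm
  exists_pow_mem_range := by
    obtain ⟨k, rfl⟩ := Nat.exists_eq_add_of_le' (show 2 ≤ n by omega)
    refine ⟨(k + 2) * 2, by omega, fun w => ?_⟩
    have hg := quotientLinking_twistHom (w ^ (k + 2))
    have hker : (quotientPerm (k + 2)).prod (residueExponent (k + 2))
        (twistHom k (w ^ (k + 2))) = 1 :=
      Prod.ext (congrArg SemidirectProduct.right hg)
        (residueExponent_of_quotientLinking_eq_inl_pow (w := w ^ 2) (by rw [hg, pow_right_comm]))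
    have hmem : twistHom k (w ^ (k + 2)) ∈ cyclicSubgroup (k + 2) :=
      Subgroup.mem_comap.mpr (hker ▸ Subgroup.one_mem _)
    refine ⟨⟨_, hmem⟩, ?_⟩
    rw [MonoidHom.comp_apply, MonoidHom.comp_apply, Subgroup.subtype_apply, hg, pow_mul]
    exact SemidirectProduct.map_inl ..

end Cyclic

/-! ### Braids placed side by side -/

section Restriction

variable {n m : ℕ} {b : Fin n ↪ Fin m}

theorem inv_apply_embedding {g : Equiv.Perm (Fin n)} {g' : Equiv.Perm (Fin m)}
    (h : ∀ a, g' (b a) = b (g a)) (a : Fin n) : g'⁻¹ (b a) = b (g⁻¹ a) := by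
  rw [Equiv.Perm.inv_eq_iff_eq, h]
  exact congrArg b (g.apply_symm_apply a).symm

theorem smul_map_embedding {g : Equiv.Perm (Fin n)} {g' : Equiv.Perm (Fin m)}
    (h : ∀ a, g' (b a) = b (g a)) (s : StrandPair n) :
    g' • Set.powersetCard.map 2 b s = Set.powersetCard.map 2 b (g • s) := by
  refine Subtype.ext ?_
  simp only [Set.powersetCard.coe_smul, Set.powersetCard.val_map, Finset.smul_finset_def,
    Finset.map_eq_image, Finset.image_image]
  exact Finset.image_congr fun a _ => h a

/-- The pairs of an element of the linking group of `n` strands and an element of the linking group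
of `m` strands whose restriction along `b` is the first element. -/
def restrictionGraph (b : Fin n ↪ Fin m) : Subgroup (LinkingGroup n × LinkingGroup m) where
  carrier := {p | (∀ a, p.2.right (b a) = b (p.1.right a)) ∧
    ∀ s, p.2.left (Set.powersetCard.map 2 b s) = p.1.left s}
  one_mem' := ⟨fun _ => rfl, fun _ => rfl⟩
  mul_mem' := by
    rintro ⟨x, x'⟩ ⟨y, y'⟩ ⟨hx, hx'⟩ ⟨hy, hy'⟩
    refine ⟨fun a => (congrArg _ (hy a)).trans (hx _), fun s => ?_⟩
    dsimp only [Prod.mk_mul_mk] at hx hx' hy hy' ⊢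
    rw [IntWreath.mul_left_apply, IntWreath.mul_left_apply, hx',
      smul_map_embedding (inv_apply_embedding hx), hy']
  inv_mem' := by
    rintro ⟨x, x'⟩ ⟨hx, hx'⟩
    refine ⟨inv_apply_embedding hx, fun s => congrArg (·⁻¹) ?_⟩
    have hs := smul_map_embedding (inv_apply_embedding (inv_apply_embedding hx)) s
    exact (congrArg x'.left hs).trans (hx' _)

theorem eq_one_of_mem_restrictionGraph {x : LinkingGroup n}
    (hx : (x, 1) ∈ restrictionGraph b) : x = 1 :=
  SemidirectProduct.ext (funext fun s => (hx.2 s).symm)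
    (Equiv.ext fun a => b.injective (hx.1 a).symm)

end Restriction

section Juxtaposition

variable {n m o : ℕ}

/-- The inclusion of the positions `o, …, o + n - 1`. -/
def blockEmb (h : o + n ≤ m) : Fin n ↪ Fin m := (Fin.natAddEmb o).trans (Fin.castLEEmb h)

theorem coe_blockEmb (h : o + n ≤ m) (a : Fin n) : (blockEmb h a : ℕ) = o + a := rfl

theorem adjSwap_blockEmb (h : o + n ≤ m) {i : ℕ} (hi : i + 1 < n) (a : Fin n) :
    adjSwap m (o + i) (blockEmb h a) = blockEmb h (adjSwap n i a) := by
  rw [Fin.ext_iff, coe_blockEmb, coe_adjSwap_apply (by omega), coe_adjSwap_apply hi, coe_blockEmb]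
  grind

theorem adjSwap_blockEmb_of_disjoint (h : o + n ≤ m) {k : ℕ} (hk : k + 1 < m)
    (hd : k + 1 < o ∨ o + n ≤ k) (a : Fin n) : adjSwap m k (blockEmb h a) = blockEmb h a := by
  rw [Fin.ext_iff, coe_adjSwap_apply hk, coe_blockEmb, if_neg (by omega), if_neg (by omega)]

theorem map_blockEmb_eq_adjPair_iff (h : o + n ≤ m) {i : ℕ} (hi : i + 1 < n) {s : StrandPair n} :
    Set.powersetCard.map 2 (blockEmb h) s = adjPair (o + i) (by omega) ↔ s = adjPair i hi := by
  have hadj : Set.powersetCard.map 2 (blockEmb h) (adjPair i hi) = adjPair (o + i) (by omega) :=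
    Subtype.ext (by
      simp only [adjPair, Set.powersetCard.ofCard, Set.powersetCard.val_map, Finset.map_insert,
        Finset.map_singleton]
      rfl)
  rw [← hadj, Subtype.ext_iff, Subtype.ext_iff]
  exact Finset.map_inj

theorem map_blockEmb_ne_adjPair_of_disjoint (h : o + n ≤ m) {k : ℕ} (hk : k + 1 < m)
    (hd : k + 1 < o ∨ o + n ≤ k) (s : StrandPair n) :
    Set.powersetCard.map 2 (blockEmb h) s ≠ adjPair k hk := fun hs => by
  have hmem : (⟨k, by omega⟩ : Fin m) ∈ Set.powersetCard.map 2 (blockEmb h) s :=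
    hs ▸ mem_adjPair.mpr (.inl rfl)
  obtain ⟨a, -, ha⟩ := (Set.powersetCard.mem_map_iff_mem_range ..).mp hmem
  have hval : o + (a : ℕ) = k := congrArg Fin.val ha
  omega

theorem single_adjPair_mem_restrictionGraph (h : o + n ≤ m) {i : ℕ} (hi : i + 1 < n) :
    (IntWreath.single (adjPair i hi) (adjSwap n i),
      IntWreath.single (adjPair (o + i) (by omega)) (adjSwap m (o + i))) ∈
        restrictionGraph (blockEmb h) := by
  refine ⟨adjSwap_blockEmb h hi, fun s => ?_⟩
  simp only [IntWreath.single, Pi.mulSingle_apply, map_blockEmb_eq_adjPair_iff h hi]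

theorem single_adjPair_mem_restrictionGraph_of_disjoint (h : o + n ≤ m) {k : ℕ} (hk : k + 1 < m)
    (hd : k + 1 < o ∨ o + n ≤ k) :
    (1, IntWreath.single (adjPair k hk) (adjSwap m k)) ∈ restrictionGraph (blockEmb h) :=
  ⟨adjSwap_blockEmb_of_disjoint h hk hd, fun s =>
    Pi.mulSingle_eq_of_ne (map_blockEmb_ne_adjPair_of_disjoint h hk hd s) _⟩

/-- The homomorphism into `B_m / [P_m, P_m]` that puts the strands of a braid at the positions
`o, …, o + n - 1`. -/
def braidShift (h : o + n ≤ m) : BraidGroup n →* BraidQuotient m :=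
  braidLift (t := fun i => artinClass m (o + i))
    { comm i j hij hj := (braidRelations_artinClass m).comm _ _ (by omega) (by omega)
      braid i hi := (braidRelations_artinClass m).braid (o + i) (by omega) }

theorem braidShift_artinGen (h : o + n ≤ m) {i : ℕ} (hi : i + 1 < n) :
    braidShift h (artinGen n i) = artinClass m (o + i) :=
  braidLift_artinGen _ hi

theorem quotientPerm_braidShift (h : o + n ≤ m) (g : BraidGroup n) :
    quotientPerm m (braidShift h g) = (braidPerm n g).viaEmbedding (blockEmb h) := by
  suffices (quotientPerm m).comp (braidShift h) =
      (Equiv.Perm.viaEmbeddingHom (blockEmb h)).comp (braidPerm n) from DFunLike.congr_fun this g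
  refine monoidHom_ext_artinGen fun i hi => Equiv.ext fun x => ?_
  rw [MonoidHom.comp_apply, MonoidHom.comp_apply, braidShift_artinGen h hi, braidPerm_artinGen,
    quotientPerm_artinClass, Equiv.Perm.viaEmbeddingHom_apply]
  by_cases hx : x ∈ Set.range (blockEmb h)
  · obtain ⟨a, rfl⟩ := hx
    rw [Equiv.Perm.viaEmbedding_apply, adjSwap_blockEmb h hi]
  · have hout : ∀ a, a < n → (x : ℕ) ≠ o + a := fun a ha hxa => hx ⟨⟨a, ha⟩, Fin.ext hxa.symm⟩
    rw [Equiv.Perm.viaEmbedding_apply_of_notMem _ _ _ hx, Fin.ext_iff,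
      coe_adjSwap_apply (show o + i + 1 < m by omega), if_neg (hout i (by omega)),
      if_neg (show (x : ℕ) ≠ o + i + 1 from hout (i + 1) hi)]

theorem commutator_pureBraidGroup_le_ker_braidShift (h : o + n ≤ m) :
    ⁅pureBraidGroup n, pureBraidGroup n⁆ ≤ (braidShift h).ker := by
  have hpure : ∀ g ∈ pureBraidGroup n, quotientPerm m (braidShift h g) = 1 := fun g hg => by
    rw [quotientPerm_braidShift, show braidPerm n g = 1 from hg]
    exact map_one (Equiv.Perm.viaEmbeddingHom (blockEmb h))
  rw [Subgroup.commutator_le]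
  intro x hx y hy
  rw [MonoidHom.mem_ker, map_commutatorElement, commutatorElement_eq_one_iff_commute]
  exact commute_of_quotientPerm_eq_one (hpure x hx) (hpure y hy)

/-- The homomorphism induced by `braidShift` on `B_n / [P_n, P_n]`. -/
def quotientShift (h : o + n ≤ m) : BraidQuotient n →* BraidQuotient m :=
  QuotientGroup.lift _ (braidShift h) (commutator_pureBraidGroup_le_ker_braidShift h)

theorem quotientShift_artinClass (h : o + n ≤ m) {i : ℕ} (hi : i + 1 < n) :
    quotientShift h (artinClass n i) = artinClass m (o + i) :=
  braidShift_artinGen h hi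

theorem range_quotientShift (h : o + n ≤ m) :
    (quotientShift h).range = initialClosure (fun i => artinClass m (o + i)) (n - 1) := by
  rw [MonoidHom.range_eq_map, ← initialClosure_artinClass, map_initialClosure]
  refine congrArg Subgroup.closure (Set.image_congr fun i hi => ?_)
  exact quotientShift_artinClass h (Nat.add_lt_of_lt_sub hi)

theorem commute_quotientShift {n' o' : ℕ} (h : o + n ≤ m) (h' : o' + n' ≤ m)
    (hoo : o + n ≤ o') (x : BraidQuotient n) (y : BraidQuotient n') :
    Commute (quotientShift h x) (quotientShift h' y) := by
  have hle : (quotientShift h').range ≤ Subgroup.centralizer (quotientShift h).range := by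
    rw [range_quotientShift, range_quotientShift, initialClosure, initialClosure,
      Subgroup.centralizer_closure, Subgroup.closure_le]
    rintro _ ⟨j, hj, rfl⟩
    rintro _ ⟨i, hi, rfl⟩
    rw [Set.mem_Iio] at hi hj
    exact (braidRelations_artinClass m).comm _ _ (by omega) (by omega)
  exact Subgroup.mem_centralizer_iff.mp (hle ⟨y, rfl⟩) _ ⟨x, rfl⟩

theorem quotientShift_mem_restrictionGraph (h : o + n ≤ m) (g : BraidQuotient n) :
    (quotientLinking n g, quotientLinking m (quotientShift h g)) ∈
      restrictionGraph (blockEmb h) := by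
  suffices initialClosure (artinClass n) (n - 1) ≤ (restrictionGraph (blockEmb h)).comap
      ((quotientLinking n).prod ((quotientLinking m).comp (quotientShift h))) from
    this ((initialClosure_artinClass n).ge (Subgroup.mem_top g))
  refine (Subgroup.closure_le _).mpr ?_
  rintro _ ⟨i, hi, rfl⟩
  rw [Set.mem_Iio] at hi
  rw [SetLike.mem_coe, Subgroup.mem_comap, MonoidHom.prod_apply, MonoidHom.comp_apply,
    quotientShift_artinClass h (by omega), quotientLinking_artinClass (by omega),
    quotientLinking_artinClass (by omega)]
  exact single_adjPair_mem_restrictionGraph h (by omega)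

theorem quotientShift_mem_restrictionGraph_of_disjoint {n' o' : ℕ} (h : o + n ≤ m)
    (h' : o' + n' ≤ m) (hd : o' + n' ≤ o ∨ o + n ≤ o') (g : BraidQuotient n') :
    (1, quotientLinking m (quotientShift h' g)) ∈ restrictionGraph (blockEmb h) := by
  suffices (quotientShift h').range ≤ (restrictionGraph (blockEmb h)).comap
      ((1 : BraidQuotient m →* LinkingGroup n).prod (quotientLinking m)) from this ⟨g, rfl⟩
  rw [range_quotientShift]
  refine (Subgroup.closure_le _).mpr ?_
  rintro _ ⟨i, hi, rfl⟩
  rw [Set.mem_Iio] at hi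
  rw [SetLike.mem_coe, Subgroup.mem_comap, MonoidHom.prod_apply,
    quotientLinking_artinClass (by omega)]
  exact single_adjPair_mem_restrictionGraph_of_disjoint h (by omega) (by omega)

/-- The first position of the `i`-th of a sequence of consecutive blocks. -/
def blockStart {t : ℕ} (n : Fin t → ℕ) (i : Fin t) : ℕ := ∑ l ∈ Finset.Iio i, n l

variable {t : ℕ} {n : Fin t → ℕ}

theorem blockStart_add (i : Fin t) : blockStart n i + n i = ∑ l ∈ Finset.Iic i, n l := by
  rw [blockStart, ← Finset.Iic_erase, Finset.sum_erase_add _ _ (Finset.mem_Iic.mpr le_rfl)]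

theorem blockStart_add_le {i j : Fin t} (h : i < j) :
    blockStart n i + n i ≤ blockStart n j :=
  (blockStart_add i).trans_le <|
    Finset.sum_le_sum_of_subset fun _ hl => Finset.mem_Iio.mpr ((Finset.mem_Iic.mp hl).trans_lt h)

theorem blockStart_add_le_of_sum_le (hm : ∑ i, n i ≤ m) (i : Fin t) :
    blockStart n i + n i ≤ m :=
  (blockStart_add i).trans_le <|
    (Finset.sum_le_sum_of_subset (Finset.subset_univ _)).trans hm

theorem pairwise_commute_quotientShift (hm : ∑ i, n i ≤ m) :
    Pairwise fun i j => ∀ (x : BraidQuotient (n i)) (y : BraidQuotient (n j)),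
      Commute (quotientShift (blockStart_add_le_of_sum_le hm i) x)
        (quotientShift (blockStart_add_le_of_sum_le hm j) y) := fun _ _ hij x y =>
  hij.lt_or_gt.elim (fun hlt => commute_quotientShift _ _ (blockStart_add_le hlt) x y)
    fun hgt => (commute_quotientShift _ _ (blockStart_add_le hgt) y x).symm

/-- The homomorphism that places braids side by side. -/
noncomputable def juxtapose (hm : ∑ i, n i ≤ m) : (∀ i, BraidQuotient (n i)) →* BraidQuotient m :=
  MonoidHom.noncommPiCoprod (fun i => quotientShift (blockStart_add_le_of_sum_le hm i))
    (pairwise_commute_quotientShift hm)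

theorem juxtapose_mulSingle (hm : ∑ i, n i ≤ m) (i : Fin t) (g : BraidQuotient (n i)) :
    juxtapose hm (Pi.mulSingle i g) = quotientShift (blockStart_add_le_of_sum_le hm i) g :=
  MonoidHom.noncommPiCoprod_mulSingle ..

theorem juxtapose_mulSingle_braidQuotientGen (hm : ∑ i, n i ≤ m) {i : Fin t} {j : Fin (n i - 1)}
    {k : Fin (m - 1)} (hk : (k : ℕ) = blockStart n i + j) :
    juxtapose hm (Pi.mulSingle i (braidQuotientGen (n i) j)) = braidQuotientGen m k := by
  rw [juxtapose_mulSingle, ← artinClass_coe, ← artinClass_coe, hk,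
    quotientShift_artinClass _ (by omega)]

theorem juxtapose_mem_restrictionGraph (hm : ∑ i, n i ≤ m) (g : ∀ i, BraidQuotient (n i))
    (i : Fin t) : (quotientLinking (n i) (g i), quotientLinking m (juxtapose hm g)) ∈
      restrictionGraph (blockEmb (blockStart_add_le_of_sum_le hm i)) := by
  let f : (∀ i, BraidQuotient (n i)) →* LinkingGroup (n i) × LinkingGroup m :=
    ((quotientLinking (n i)).comp (Pi.evalMonoidHom _ i)).prod
      ((quotientLinking m).comp (juxtapose hm))
  suffices g ∈ (restrictionGraph (blockEmb (blockStart_add_le_of_sum_le hm i))).comap f from this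
  refine Subgroup.pi_mem_of_mulSingle_mem g fun l => ?_
  rw [Subgroup.mem_comap, MonoidHom.prod_apply, MonoidHom.comp_apply, MonoidHom.comp_apply,
    juxtapose_mulSingle, Pi.evalMonoidHom_apply]
  by_cases hl : l = i
  · subst hl
    rw [Pi.mulSingle_eq_same]
    exact quotientShift_mem_restrictionGraph _ _
  · rw [Pi.mulSingle_eq_of_ne' hl, map_one]
    exact quotientShift_mem_restrictionGraph_of_disjoint _ _
      ((lt_or_gt_of_ne hl).imp blockStart_add_le blockStart_add_le) _

theorem juxtapose_injective (hm : ∑ i, n i ≤ m) : Function.Injective (juxtapose hm) := by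
  refine (injective_iff_map_eq_one _).mpr fun g hg => funext fun i => ?_
  have hmem := juxtapose_mem_restrictionGraph hm g i
  rw [hg, map_one] at hmem
  exact (map_eq_one_iff _ (quotientLinking_injective _)).mp (eq_one_of_mem_restrictionGraph hmem)

end Juxtaposition

/-! ### Bieberbach subgroups -/

section Bieberbach

theorem choose_two_add_choose_two_le (a b : ℕ) : a.choose 2 + b.choose 2 ≤ (a + b).choose 2 := by
  induction a with
  | zero => simp
  | succ a ih =>
    rw [Nat.add_right_comm, Nat.choose_succ_succ', Nat.choose_succ_succ', Nat.choose_one_right,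
      Nat.choose_one_right, one_add_one_eq_two]
    omega

theorem sum_choose_two_le {ι : Type*} (s : Finset ι) (n : ι → ℕ) :
    ∑ i ∈ s, (n i).choose 2 ≤ (∑ i ∈ s, n i).choose 2 := by
  classical
  induction s using Finset.induction_on with
  | empty => rfl
  | insert a s ha ih =>
    rw [Finset.sum_insert ha, Finset.sum_insert ha]
    exact (Nat.add_le_add_left ih _).trans (choose_two_add_choose_two_le _ _)

theorem card_strandPair (n : ℕ) : Nat.card (StrandPair n) = n.choose 2 := by
  rw [Set.powersetCard.card, Nat.card_fin]

theorem isBieberbach_cyclicSubgroup {n : ℕ} (hn : 3 ≤ n) :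
    IsBieberbach (n.choose 2) (Multiplicative (ZMod n)) (cyclicSubgroup n) := by
  have : NeZero n := ⟨by omega⟩
  have : Finite (Multiplicative (ZMod n)) := inferInstanceAs (Finite (ZMod n))
  rw [← card_strandPair]
  exact (isLatticeRepresentation_cyclicSubgroup hn).isBieberbach fun g hg => Subtype.ext <|
    eq_one_of_isOfFinOrder_of_mem_cyclicSubgroup (by omega) g.2
      ((cyclicSubgroup n).subtype.isOfFinOrder hg)

/-- A product of subgroups of the factors of a product of groups is isomorphic to the product of the
subgroups as abstract groups. -/
def subgroupPiEquiv {ι : Type*} {G : ι → Type*} [∀ i, Group (G i)] (H : ∀ i, Subgroup (G i)) :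
    Subgroup.pi Set.univ H ≃* ∀ i, H i where
  toFun g i := ⟨g.1 i, g.2 i trivial⟩
  invFun g := ⟨fun i => g i, fun i _ => (g i).2⟩
  left_inv _ := rfl
  right_inv _ := rfl
  map_mul' _ _ := rfl

variable {t m : ℕ} {n : Fin t → ℕ}

theorem isBieberbach_map_juxtapose (hn : ∀ i, 3 ≤ n i) (hm : ∑ i, n i ≤ m) :
    IsBieberbach (∑ i, (n i).choose 2) (Multiplicative (∀ i, ZMod (n i)))
      ((Subgroup.pi Set.univ fun i => cyclicSubgroup (n i)).map (juxtapose hm)) := by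
  have : ∀ i, NeZero (n i) := fun i => ⟨by have := hn i; omega⟩
  have : Finite (Multiplicative (∀ i, ZMod (n i))) := inferInstanceAs (Finite (∀ i, ZMod (n i)))
  have hcard : Nat.card (Σ i, StrandPair (n i)) = ∑ i, (n i).choose 2 := by
    simp only [Nat.card_sigma, card_strandPair]
  let e := ((Subgroup.pi Set.univ fun i => cyclicSubgroup (n i)).equivMapOfInjective _
    (juxtapose_injective hm)).symm.trans (subgroupPiEquiv _)
  rw [← hcard]
  refine ((IsLatticeRepresentation.pi fun i =>
    isLatticeRepresentation_cyclicSubgroup (hn i)).congr e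
      (MulEquiv.piMultiplicative _).symm).isBieberbach fun g hg => ?_
  rw [← map_eq_one_iff e e.injective]
  refine funext fun i => (isBieberbach_cyclicSubgroup (hn i)).torsionFree _ ?_
  exact ((Pi.evalMonoidHom _ i).comp e.toMonoidHom).isOfFinOrder hg

end Bieberbach

theorem proposition3p2_general (t : ℕ) (n : Fin t → ℕ) (hn : ∀ i, 3 ≤ n i) (m : ℕ)
    (hm : ∑ i, n i ≤ m) :
    ∑ i, (n i).choose 2 ≤ m.choose 2 ∧
    ∃ Γ : Subgroup (BraidQuotient m),
      IsBieberbach (∑ i, (n i).choose 2) (Multiplicative (∀ i, ZMod (n i))) Γ ∧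
      ∃ (Δ : ∀ i, Subgroup (BraidQuotient (n i)))
        (ι : (∀ i, BraidQuotient (n i)) →* BraidQuotient m),
        (∀ i, IsBieberbach ((n i).choose 2) (Multiplicative (ZMod (n i))) (Δ i)) ∧
        Function.Injective ι ∧
        (∀ (i : Fin t) (j : Fin (n i - 1)) (k : Fin (m - 1)),
          (k : ℕ) = (∑ l ∈ Finset.Iio i, n l) + (j : ℕ) →
            ι (Pi.mulSingle i (braidQuotientGen (n i) j)) = braidQuotientGen m k) ∧
        Γ = (Subgroup.pi Set.univ Δ).map ι :=
  ⟨(sum_choose_two_le _ n).trans (Nat.choose_le_choose 2 hm), _,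
    isBieberbach_map_juxtapose hn hm, fun i => cyclicSubgroup (n i), juxtapose hm,
    fun i => isBieberbach_cyclicSubgroup (hn i), juxtapose_injective hm,
    fun _ _ _ hk => juxtapose_mulSingle_braidQuotientGen hm hk, rfl⟩

theorem proposition3p2 (t : ℕ) (n : Fin t → ℕ) (hpp : ∀ i, IsPrimePow (n i))
    (hn : ∀ i, 3 ≤ n i) (m : ℕ) (hm : ∑ i, n i ≤ m) :
    ∑ i, (n i).choose 2 ≤ m.choose 2 ∧
    ∃ Γ : Subgroup (BraidQuotient m),
      -- `Γ` is a Bieberbach subgroup with the stated dimension and holonomy group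
      IsBieberbach (∑ i, (n i).choose 2) (Multiplicative (∀ i, ZMod (n i))) Γ ∧
      -- `Γ` is the image of a product of Bieberbach subgroups of the `B_{n_i} / [P_{n_i}, P_{n_i}]`
      -- under the embedding that places the braids side by side
      ∃ (Δ : ∀ i, Subgroup (BraidQuotient (n i)))
        (ι : (∀ i, BraidQuotient (n i)) →* BraidQuotient m),
        (∀ i, IsBieberbach ((n i).choose 2) (Multiplicative (ZMod (n i))) (Δ i)) ∧
        Function.Injective ι ∧
        (∀ (i : Fin t) (j : Fin (n i - 1)) (k : Fin (m - 1)),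
          (k : ℕ) = (∑ l ∈ Finset.Iio i, n l) + (j : ℕ) →
            ι (Pi.mulSingle i (braidQuotientGen (n i) j)) = braidQuotientGen m k) ∧
        Γ = (Subgroup.pi Set.univ Δ).map ι :=
  proposition3p2_general t n hn m hm
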